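/- **Setting.** Let $\Sigma$ be an order-sorted signature of messages with a sort $\mathsf{Msg}$ that is the top of its connected component and a sort $\mathsf{Fresh}$, with countably infinitely many variables of each sort, and with constants $r.ro.i$ of sort $\mathsf{Fresh}$ (the name given to the fresh variable $r$ in session $i$ of role $ro$). Let $E$ be a set of $\Sigma$-equations, $=_E$ the induced congruence, and assume that every sort has a ground term. Messages are considered modulo $E$. *Processes* are generated by $P ::= nilP \mid +M \mid -M \mid P\cdot P \mid P\,?\,P \mid \mathit{if}\ T\ \mathit{then}\ P\ \mathit{else}\ P$ with $T ::= M=M' \mid M\neq M'$, where $\cdot$ is associative with identity $nilP$. A *protocol* $\mathcal P$ assigns to each role $ro$ a well-formed process $P_{ro}$. Here $wf(nilP)$ holds; $wf(P\cdot \pm M)$ iff $wf(P)$ and $Var(M)\cap Var(P)\subseteq shVar(P)$; $wf(P\cdot(\mathit{if}\ T\ \mathit{then}\ Q\ \mathit{else}\ R))$ iff $wf(P\cdot Q)$, $wf(P\cdot R)$, $P,Q\ne nilP$ and $Var(T)\subseteq shVar(P)$; $wf(P\cdot(Q\,?\,R))$ iff $wf(P\cdot Q)$, $wf(P\cdot R)$,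 and $Q\neq nilP$ or $R\ne nilP$; $shVar$ collects the variables of messages and conditions, intersecting the two branches of a choice. The variables of sort $\mathsf{Fresh}$ are the fresh variables. The other variables of the processes have sorts $\le\mathsf{Msg}$ and are divided into choice and pattern variables: along each execution path, a variable first occurring in a sent message is a fresh or choice variable, one first occurring in a received message is a pattern variable. $\mathcal P_{Cstr}$ is the set of labeled strands $(ro)[u_1,\dots,u_n]$ that are the execution paths of the $P_{ro}$; each $u_k$ is $+M$, $-M$, $\{?,n\}$ (branch $n\in\{1,2\}$ of a nondeterministic choice), $\{T,1\}$ (then) or $\{\neg T,2\}$ (else). **Process algebra semantics.** States $\{LP_1\&\dots\&LP_n\mid\{IK\}\}$ consist of a multiset of labeled processes $(ro,i,j)\,P$ and a set $IK$ of known messages; $P_{init}=\{\emptyset\mid\{empty\}\}$. Transitions carry labels $(ro,i,j,a,n)$ and increase $j$ by one. (1) $(ro,i,j)(+M\cdot P)$ becomes $(ro,i,j+1)P\sigma$, for any ground substitution $\sigma$ of the choice variables of $M$; either $M\sigma$, not yet in $IK$, is added to $IK$ (label $a=+M\sigma$), or $IK$ is unchanged ($a=M\sigma$). (2) $(ro,i,j)(-M\cdot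 P)$ becomes $(ro,i,j+1)P\sigma$ if $M\sigma\in IK$ modulo $E$, where $\sigma$ grounds the variables of $M$ ($a=-M\sigma$). (3) $(\mathit{if}\ T\ \mathit{then}\ P\ \mathit{else}\ Q)\cdot R$ becomes $P\cdot R$ if $T$ holds modulo $E$ ($n=1$), and $Q\cdot R$ otherwise ($n=2$), with $a$ marking a deterministic choice. (4) $(P\,?\,Q)\cdot R$ becomes $P\cdot R$ ($n=1$) or $Q\cdot R$ ($n=2$), with $a={?}$. In (1), (2), $n=0$. (5) A new process $(ro,i+1,1)P_{ro}\rho_{ro,i+1}$ may be added together with its first step, where $i$ is the largest identifier of role $ro$ in the state ($0$ if none) and $\rho_{ro,i}=\{r\mapsto r.ro.i\}$ on fresh variables. A PA-State is a state reachable from $P_{init}$. **Constrained forwards strand semantics.** States consist of a multiset of labeled ground strands $(ro,i)[v_1,\dots,v_k]$ (already executed parts) and a set $IK$; $F_{init}$ has no strands and empty $IK$. For $(ro)[u_1,\dots,u_j,\dots,u_n]\in\mathcal P_{Cstr}$, $j>1$, and a ground substitution $\tau$ extending $\rho_{ro,i}$, a strand $(ro,i)[u_1\tau,\dots,u_{j-1}\tau]$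 may be extended by $u_j\tau$ with label $(ro,i,j,a,n)$: a sent message is either learnt, if not yet in $IK$, or not learnt; a received message must be in $IK$; a constraint $\{T,n\}$ requires that $T\tau$ holds modulo $E$; $\{?,n\}$ is unconditional; $a$ and $n$ are as above. For $j=1$ and $u_1$ of the form $+M$, $-M$ or $\{?,n\}$, a new strand $(ro,i+1)[u_1\tau]$ is added, with $i$ the largest identifier of role $ro$ in the state and $\tau$ extending $\rho_{ro,i+1}$. An FW-State is a state reachable from $F_{init}$. The relation $\mathcal H$ holds between a PA-State $Pst$ and an FW-State $Fst$ iff some label sequence $\alpha$ satisfies $P_{init}\to_\alpha Pst$ and $F_{init}\to_\alpha Fst$. **Constrained backwards strand semantics.** A constrained symbolic strand state $CstrS=\langle S,\Psi\rangle$ consists of a conjunction $\Psi$ of disequalities between messages and a state $S$ made of strands $[u_1,\dots,u_{i-1}\mid u_i,\dots,u_n]$, each an instance modulo $E$ (by a substitution) of a strand in $\mathcal P_{Cstr}$ (labels omitted), facts $m\in\mathcal I$ and $m\notin\mathcal I$, at least one variable $SS$ for sets of strands, and at least one variable $IK$ for sets of facts. Unions $\&$ and "," are associative, commutative, with identity;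 lists are associative with identity $nil$. It is *initial* if in every strand the bar is at the beginning and there is no fact $m\in\mathcal I$. The backwards rules are the following, reversed: $$\begin{aligned} &\langle\{SS\,\&\,[L\mid M^-,L']\,\&\,\{M\in\mathcal I,IK\}\},\Psi\rangle\to\langle\{SS\,\&\,[L,M^-\mid L']\,\&\,\{M\in\mathcal I,IK\}\},\Psi\rangle\\ &\langle\{SS\,\&\,[L\mid M^+,L']\,\&\,\{IK\}\},\Psi\rangle\to\langle\{SS\,\&\,[L,M^+\mid L']\,\&\,\{IK\}\},\Psi\rangle\\ &\langle\{SS\,\&\,[L\mid M^+,L']\,\&\,\{M\notin\mathcal I,IK\}\},\Psi\rangle\to\langle\{SS\,\&\,[L,M^+\mid L']\,\&\,\{M\in\mathcal I,IK\}\},\Psi\rangle\\ &\langle\{SS\,\&\,[l_1\mid u^+,l_2]\,\&\,\{u\notin\mathcal I,IK\}\},\Psi\rangle\to\langle\{SS\,\&\,\{u\in\mathcal I,IK\}\},\Psi\rangle\quad\text{for each }[l_1,u^+,l_2]\in\mathcal P_{Cstr}\\ &\langle\{SS\,\&\,[L\mid\{?,n\},L']\,\&\,\{IK\}\},\Psi\rangle\to\langle\{SS\,\&\,[L,\{?,n\}\mid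 L']\,\&\,\{IK\}\},\Psi\rangle\\ &\langle\{SS\,\&\,[L\mid\{M=M,n\},L']\,\&\,\{IK\}\},\Psi\rangle\to\langle\{SS\,\&\,[L,\{M=M,n\}\mid L']\,\&\,\{IK\}\},\Psi\rangle\\ &\langle\{SS\,\&\,[L\mid\{M\ne M',n\},L']\,\&\,\{IK\}\},\Psi\wedge M\neq M'\rangle\to\langle\{SS\,\&\,[L,\{M\neq M',n\}\mid L']\,\&\,\{IK\}\},\Psi\rangle \end{aligned}$$ the last one only if $\Psi\wedge M\ne M'$ is satisfiable in the free $(\Sigma,E)$-algebra over the variables. A backwards narrowing step $CstrS'\leftsquigarrow_\sigma CstrS$ applies a reversed rule $l\to r$, renamed apart from a finite set $W$ of variables containing those of $CstrS$, with $\sigma$ taken from a complete set of unifiers of $S=l$ (modulo $E$ and the axioms above) away from $W\cup Var(l)\cup Var(r)$; $\stackrel{*}{\leftsquigarrow}_\mu$ is its reflexive-transitive closure, $\mu$ being the composition of the unifiers. For $CstrS=\langle S,\Psi\rangle$, a ground strand state $s$ and a ground substitution $\theta$, write $CstrS>^\theta s$ iff (a) for each strand $[u_1,\dots,u_{i-1}\mid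 u_i,\dots,u_n]$ in $S$ with $i>1$ there is a strand $[v_1,\dots,v_{i-1}]$ in $s$ with $v_j=_E u_j\theta$ for all $j<i$; (b) for each fact $w\in\mathcal I$ in $S$, $w\theta$ is known in $s$ modulo $E$; (c) for each fact $w\notin\mathcal I$ in $S$, $w\theta$ is not known in $s$ modulo $E$; (d) $u\theta\neq_E v\theta$ for each disequality $u\ne v$ of $\Psi$. **Theorem (Completeness).** Let $\mathcal P$ be a protocol, and fix any procedure which yields, for each unification problem between states and each finite set of variables containing those of the problem, a complete set of unifiers away from that set. Let $Pst$ be a PA-State, $Fst$ an FW-State, $CstrS$ a constrained symbolic strand state and $\theta'$ a ground substitution such that $Pst\ \mathcal H\ Fst$ and $CstrS>^{\theta'}Fst$. Then there are a constrained symbolic strand state $CstrS_0$, a substitution $\mu$ and a ground substitution $\theta$ such that $CstrS_0\stackrel{*}{\leftsquigarrow}_\mu CstrS$ by backwards narrowing with the unifiers of this procedure, $CstrS_0$ is initial, and $CstrS_0>^{\theta}F_{init}$. -/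

import Mathlib

universe u v w

namespace MNPA

/-! ## Order-sorted signatures, terms and equational logic -/

/-- An order-sorted signature for messages.  `decl f ss s` says that `f : ss → s` is one of the
(possibly several, subsort-overloaded) declarations of the symbol `f`. -/
structure Signature where
  Srt : Type u
  [ord : PartialOrder Srt]
  Op : Type v
  arity : Op → ℕ
  decl : (f : Op) → (Fin (arity f) → Srt) → Srt → Prop
  /-- the sort of messages -/
  msg : Srt
  /-- the sort of fresh variables and fresh names -/
  fresh : Srt
  /-- `msg` is the top sort of its connected component -/
  msg_top : ∀ s, Relation.EqvGen (fun a b : Srt => a ≤ b) s msg → s ≤ msg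

attribute [instance] Signature.ord

/-- Sorted variables: every sort has countably infinitely many. -/
structure Var (Sg : Signature.{u, v}) where
  sort : Sg.Srt
  idx : ℕ

/-- Terms.  The constant `name r ro i` is the unique name `r.ro.i` which session `i` of role `ro`
gives to the fresh variable of sort `fresh` with index `r`. -/
inductive Term (Sg : Signature.{u, v}) (Role : Type w) : Type (max u v w)
  | var (x : Var Sg) : Term Sg Role
  | name (r : ℕ) (ro : Role) (i : ℕ) : Term Sg Role
  | app (f : Sg.Op) (args : Fin (Sg.arity f) → Term Sg Role) : Term Sg Role

variable {Sg : Signature.{u, v}} {Role : Type w}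

/-- `HasSort t s`: `t` is a well-formed term of sort `s`. -/
inductive HasSort : Term Sg Role → Sg.Srt → Prop
  | var (x : Var Sg) : HasSort (.var x) x.sort
  | name (r : ℕ) (ro : Role) (i : ℕ) : HasSort (.name r ro i) Sg.fresh
  | app (f : Sg.Op) (ss : Fin (Sg.arity f) → Sg.Srt) (s : Sg.Srt)
      (args : Fin (Sg.arity f) → Term Sg Role) :
      Sg.decl f ss s → (∀ k, HasSort (args k) (ss k)) → HasSort (.app f args) s
  | sub (t : Term Sg Role) (s s' : Sg.Srt) : HasSort t s → s ≤ s' → HasSort t s'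

namespace Term

def vars : Term Sg Role → Set (Var Sg)
  | var x => {x}
  | name _ _ _ => ∅
  | app _ args => ⋃ k, (args k).vars

def subst (σ : Var Sg → Term Sg Role) : Term Sg Role → Term Sg Role
  | var x => σ x
  | name r ro i => name r ro i
  | app f args => app f fun k => (args k).subst σ

def Ground (t : Term Sg Role) : Prop := t.vars = ∅

end Term

/-- A (sort-preserving) substitution. -/
def IsSubst (σ : Var Sg → Term Sg Role) : Prop := ∀ x, HasSort (σ x) x.sort

/-- A ground substitution, assigning a ground term to every variable. -/
def IsGroundSubst (τ : Var Sg → Term Sg Role) : Prop := IsSubst τ ∧ ∀ x, (τ x).Ground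

/-- Order-sorted equational deduction: the congruence `=_E` on terms. -/
inductive EqE (E : Set (Term Sg Role × Term Sg Role)) : Term Sg Role → Term Sg Role → Prop
  | refl (t) : EqE E t t
  | symm (t t') : EqE E t t' → EqE E t' t
  | trans (t t' t'') : EqE E t t' → EqE E t' t'' → EqE E t t''
  | ax (l r : Term Sg Role) (σ : Var Sg → Term Sg Role) :
      (l, r) ∈ E → IsSubst σ → EqE E (l.subst σ) (r.subst σ)
  | congr (f : Sg.Op) (ss : Fin (Sg.arity f) → Sg.Srt) (s : Sg.Srt)
      (a b : Fin (Sg.arity f) → Term Sg Role) :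
      Sg.decl f ss s → (∀ k, HasSort (a k) (ss k)) → (∀ k, HasSort (b k) (ss k)) →
      (∀ k, EqE E (a k) (b k)) → EqE E (.app f a) (.app f b)

def eqSetoid (E : Set (Term Sg Role × Term Sg Role)) : Setoid (Term Sg Role) where
  r := EqE E
  iseqv := ⟨EqE.refl, fun h => EqE.symm _ _ h, fun h h' => EqE.trans _ _ _ h h'⟩

/-- `E`-equivalence classes of terms. -/
def Cls (E : Set (Term Sg Role × Term Sg Role)) : Type (max u v w) := Quotient (eqSetoid E)

def cls (E : Set (Term Sg Role × Term Sg Role)) (t : Term Sg Role) : Cls E :=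
  Quotient.mk (eqSetoid E) t

/-! ## Constraints, strand messages, processes

These are generic in the type `α` of messages; it is instantiated by `Term Sg Role` (symbolic) and
by `Cls E` (terms modulo `E`). -/

/-- `M = M'` and `M ≠ M'`. -/
inductive Cond (α : Type*)
  | eq (a b : α) : Cond α
  | ne (a b : α) : Cond α

namespace Cond
variable {α β : Type*}

def map (f : α → β) : Cond α → Cond β
  | eq a b => eq (f a) (f b)
  | ne a b => ne (f a) (f b)

def neg : Cond α → Cond α
  | eq a b => ne a b
  | ne a b => eq a b

def msgs : Cond α → Set α
  | eq a b => {a, b}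
  | ne a b => {a, b}

/-- Truth of a constraint; used for messages modulo `E`. -/
def Holds : Cond α → Prop
  | eq a b => a = b
  | ne a b => a ≠ b

end Cond

/-- What may stand in a strand: `+M`, `-M`, `{?, n}` and `{T, n}`. -/
inductive SMsg (α : Type*)
  | send (a : α) : SMsg α
  | recv (a : α) : SMsg α
  | any (n : ℕ) : SMsg α
  | cond (c : Cond α) (n : ℕ) : SMsg α

namespace SMsg
variable {α β : Type*}

def map (f : α → β) : SMsg α → SMsg β
  | send a => send (f a)
  | recv a => recv (f a)
  | any n => any n
  | cond c n => cond (c.map f) n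

def msgs : SMsg α → Set α
  | send a => {a}
  | recv a => {a}
  | any _ => ∅
  | cond c _ => c.msgs

end SMsg

/-- Processes modulo associativity of `·` and identity `nilP`, in list form: every process is
either `nilP` or an action followed by a process.  `ite T P Q R` is `(if T then P else Q) · R`, and
`choice P Q R` is `(P ? Q) · R`. -/
inductive Proc (α : Type*)
  | nil : Proc α
  | send (M : α) (P : Proc α) : Proc α
  | recv (M : α) (P : Proc α) : Proc α
  | ite (T : Cond α) (P Q R : Proc α) : Proc α
  | choice (P Q R : Proc α) : Proc α

namespace Proc
variable {α β : Type*}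

/-- Sequential composition `P · Q`. -/
def append : Proc α → Proc α → Proc α
  | nil, X => X
  | send M P, X => send M (P.append X)
  | recv M P, X => recv M (P.append X)
  | ite T P Q R, X => ite T P Q (R.append X)
  | choice P Q R, X => choice P Q (R.append X)

def map (f : α → β) : Proc α → Proc β
  | nil => nil
  | send M P => send (f M) (P.map f)
  | recv M P => recv (f M) (P.map f)
  | ite T P Q R => ite (T.map f) (P.map f) (Q.map f) (R.map f)
  | choice P Q R => choice (P.map f) (Q.map f) (R.map f)

/-- The messages that occur in a process. -/
def msgs : Proc α → Set α
  | nil => ∅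
  | send M P => {M} ∪ P.msgs
  | recv M P => {M} ∪ P.msgs
  | ite T P Q R => T.msgs ∪ P.msgs ∪ Q.msgs ∪ R.msgs
  | choice P Q R => P.msgs ∪ Q.msgs ∪ R.msgs

def size : Proc α → ℕ
  | nil => 0
  | send _ P => P.size + 1
  | recv _ P => P.size + 1
  | ite _ P Q R => P.size + Q.size + R.size + 1
  | choice P Q R => P.size + Q.size + R.size + 1

theorem size_append (P X : Proc α) : (P.append X).size = P.size + X.size := by
  induction P with
  | nil => simp [append, size]
  | send M P ih => simp [append, size, ih]; omega
  | recv M P ih => simp [append, size, ih]; omega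
  | ite T P Q R _ _ ih => simp [append, size, ih]; omega
  | choice P Q R _ _ ih => simp [append, size, ih]; omega

/-- `toCstrSS*`, without the role label: the set of the constrained strands (the execution paths)
of a process; `L` stores the messages collected so far. -/
def toStrands : Proc α → List (SMsg α) → Set (List (SMsg α))
  | nil, L => {L}
  | send M P, L => P.toStrands (L ++ [.send M])
  | recv M P, L => P.toStrands (L ++ [.recv M])
  | ite T P Q R, L =>
      (P.append R).toStrands (L ++ [.cond T 1]) ∪ (Q.append R).toStrands (L ++ [.cond T.neg 2])
  | choice P Q R, L =>
      (P.append R).toStrands (L ++ [.any 1]) ∪ (Q.append R).toStrands (L ++ [.any 2])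
termination_by P => P.size
decreasing_by all_goals simp only [size, size_append]; omega

end Proc

def msgVars (A : Set (Term Sg Role)) : Set (Var Sg) := ⋃ t ∈ A, t.vars

def Proc.vars (P : Proc (Term Sg Role)) : Set (Var Sg) := msgVars P.msgs

/-- The shared variables of a process: those that show up in all branches. -/
def Proc.shVar : Proc (Term Sg Role) → Set (Var Sg)
  | .nil => ∅
  | .send M P => M.vars ∪ P.shVar
  | .recv M P => M.vars ∪ P.shVar
  | .ite T P Q R => msgVars T.msgs ∪ (P.shVar ∩ Q.shVar) ∪ R.shVar
  | .choice P Q R => (P.shVar ∩ Q.shVar) ∪ R.shVar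

/-- Well-formed processes. -/
inductive Proc.WF : Proc (Term Sg Role) → Prop
  | nil : WF .nil
  | send (P : Proc (Term Sg Role)) (M : Term Sg Role) :
      WF P → M.vars ∩ P.vars ⊆ P.shVar → WF (P.append (.send M .nil))
  | recv (P : Proc (Term Sg Role)) (M : Term Sg Role) :
      WF P → M.vars ∩ P.vars ⊆ P.shVar → WF (P.append (.recv M .nil))
  | ite (P : Proc (Term Sg Role)) (T : Cond (Term Sg Role)) (Q R : Proc (Term Sg Role)) :
      WF (P.append Q) → WF (P.append R) → P ≠ .nil → Q ≠ .nil → msgVars T.msgs ⊆ P.shVar →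
      WF (P.append (.ite T Q R .nil))
  | choice (P Q R : Proc (Term Sg Role)) :
      WF (P.append Q) → WF (P.append R) → (Q ≠ .nil ∨ R ≠ .nil) →
      WF (P.append (.choice Q R .nil))

def listVars (L : List (SMsg (Term Sg Role))) : Set (Var Sg) := ⋃ m ∈ L, msgVars m.msgs

/-! ## Protocols -/

/-- A protocol specification in the process algebra: an equational theory and, for every role
(honest role or attacker capability), one well-formed process.  Variables of sort `fresh` are
the fresh variables; the other variables are choice or pattern variables. -/
structure Protocol (Sg : Signature.{u, v}) (Role : Type w) where
  E : Set (Term Sg Role × Term Sg Role)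
  eq_sorted : ∀ e ∈ E, ∃ s, HasSort e.1 s ∧ HasSort e.2 s
  /-- no sort is empty -/
  ground_nonempty : ∀ s : Sg.Srt, ∃ t : Term Sg Role, HasSort t s ∧ t.Ground
  proc : Role → Proc (Term Sg Role)
  msg_sorted : ∀ ro, ∀ t ∈ (proc ro).msgs, HasSort t Sg.msg
  wf : ∀ ro, (proc ro).WF
  /-- the choice variables -/
  choiceVar : Set (Var Sg)
  choice_not_fresh : ∀ x ∈ choiceVar, x.sort ≠ Sg.fresh
  var_sorted : ∀ ro, ∀ x ∈ (proc ro).vars, x.sort ≠ Sg.fresh → x.sort ≤ Sg.msg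
  /-- variables that first appear in a sent message are fresh or choice variables -/
  first_send : ∀ ro L M L', L ++ SMsg.send M :: L' ∈ (proc ro).toStrands [] →
    ∀ x ∈ M.vars, x ∉ listVars L → x.sort = Sg.fresh ∨ x ∈ choiceVar
  /-- variables that first appear in a received message are pattern variables -/
  first_recv : ∀ ro L M L', L ++ SMsg.recv M :: L' ∈ (proc ro).toStrands [] →
    ∀ x ∈ M.vars, x ∉ listVars L → x.sort ≠ Sg.fresh ∧ x ∉ choiceVar

/-- The specification by constrained strands, obtained by `toCstrSS` from the processes. -/
def Protocol.strandSpec (P : Protocol Sg Role) : Set (Role × List (SMsg (Term Sg Role))) :=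
  {p | p.2 ∈ (P.proc p.1).toStrands []}

/-- `ρ_{ro,i}` on variables of sort `fresh`, the identity on all other variables. -/
noncomputable def freshSubst (ro : Role) (i : ℕ) (x : Var Sg) : Term Sg Role :=
  open Classical in if x.sort = Sg.fresh then .name x.idx ro i else .var x

/-! ## Transition labels -/

/-- The action in a transition label: `+m` (learnt), `m` (sent, not learnt), `-m`, `?`, and `T`
for an explicit deterministic choice. -/
inductive Action (α : Type*)
  | learn (m : α) : Action α
  | send (m : α) : Action α
  | recv (m : α) : Action α
  | any : Action α
  | det : Action α

/-- Labels `(ro, i, j, a, n)`. -/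
structure Label (Role : Type*) (α : Type*) where
  role : Role
  id : ℕ
  stage : ℕ
  act : Action α
  branch : ℕ

/-! ## Process algebra semantics -/

/-- A labeled process `(ro, i, j) P`. -/
structure LProc (Sg : Signature.{u, v}) (Role : Type w) where
  role : Role
  id : ℕ
  stage : ℕ
  proc : Proc (Term Sg Role)

/-- `{ LP₁ & … & LPₙ | {IK} }`; the intruder knowledge is a set of messages modulo `E`. -/
structure PAState (P : Protocol Sg Role) where
  procs : Multiset (LProc Sg Role)
  ik : Set (Cls P.E)

/-- `σ` is a substitution that grounds the variables in `V` and fixes all others. -/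
def Grounds (σ : Var Sg → Term Sg Role) (V : Set (Var Sg)) : Prop :=
  IsSubst σ ∧ (∀ x ∈ V, (σ x).Ground) ∧ ∀ x ∉ V, σ x = .var x

/-- The steps of one labeled process; `IK` and `IK'` are the intruder knowledge before and after. -/
inductive LPStep (P : Protocol Sg Role) :
    LProc Sg Role → Set (Cls P.E) → Label Role (Cls P.E) → LProc Sg Role → Set (Cls P.E) → Prop
  | sendLearn (ro : Role) (i j : ℕ) (M : Term Sg Role) (Q : Proc (Term Sg Role))
      (IK : Set (Cls P.E)) (σ : Var Sg → Term Sg Role) :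
      Grounds σ (M.vars ∩ P.choiceVar) → cls P.E (M.subst σ) ∉ IK →
      LPStep P ⟨ro, i, j, .send M Q⟩ IK ⟨ro, i, j, .learn (cls P.E (M.subst σ)), 0⟩
        ⟨ro, i, j + 1, Q.map (Term.subst σ)⟩ (insert (cls P.E (M.subst σ)) IK)
  | send (ro : Role) (i j : ℕ) (M : Term Sg Role) (Q : Proc (Term Sg Role))
      (IK : Set (Cls P.E)) (σ : Var Sg → Term Sg Role) :
      Grounds σ (M.vars ∩ P.choiceVar) →
      LPStep P ⟨ro, i, j, .send M Q⟩ IK ⟨ro, i, j, .send (cls P.E (M.subst σ)), 0⟩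
        ⟨ro, i, j + 1, Q.map (Term.subst σ)⟩ IK
  | recv (ro : Role) (i j : ℕ) (M : Term Sg Role) (Q : Proc (Term Sg Role))
      (IK : Set (Cls P.E)) (σ : Var Sg → Term Sg Role) :
      Grounds σ M.vars → cls P.E (M.subst σ) ∈ IK →
      LPStep P ⟨ro, i, j, .recv M Q⟩ IK ⟨ro, i, j, .recv (cls P.E (M.subst σ)), 0⟩
        ⟨ro, i, j + 1, Q.map (Term.subst σ)⟩ IK
  | ifThen (ro : Role) (i j : ℕ) (T : Cond (Term Sg Role)) (Q Q' R : Proc (Term Sg Role))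
      (IK : Set (Cls P.E)) :
      (T.map (cls P.E)).Holds →
      LPStep P ⟨ro, i, j, .ite T Q Q' R⟩ IK ⟨ro, i, j, .det, 1⟩ ⟨ro, i, j + 1, Q.append R⟩ IK
  | ifElse (ro : Role) (i j : ℕ) (T : Cond (Term Sg Role)) (Q Q' R : Proc (Term Sg Role))
      (IK : Set (Cls P.E)) :
      ¬ (T.map (cls P.E)).Holds →
      LPStep P ⟨ro, i, j, .ite T Q Q' R⟩ IK ⟨ro, i, j, .det, 2⟩ ⟨ro, i, j + 1, Q'.append R⟩ IK
  | choice1 (ro : Role) (i j : ℕ) (Q Q' R : Proc (Term Sg Role)) (IK : Set (Cls P.E)) :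
      LPStep P ⟨ro, i, j, .choice Q Q' R⟩ IK ⟨ro, i, j, .any, 1⟩ ⟨ro, i, j + 1, Q.append R⟩ IK
  | choice2 (ro : Role) (i j : ℕ) (Q Q' R : Proc (Term Sg Role)) (IK : Set (Cls P.E)) :
      LPStep P ⟨ro, i, j, .choice Q Q' R⟩ IK ⟨ro, i, j, .any, 2⟩ ⟨ro, i, j + 1, Q'.append R⟩ IK

/-- The largest identifier of a process of role `ro` (`0` if there is none). -/
def maxProcId [DecidableEq Role] (PS : Multiset (LProc Sg Role)) (ro : Role) : ℕ :=
  ((PS.filter fun p => p.role = ro).map LProc.id).sup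

/-- Transitions of the process algebra: a process of the state makes a step, or a new process is
introduced together with its first step. -/
inductive PAStep [DecidableEq Role] (P : Protocol Sg Role) :
    PAState P → Label Role (Cls P.E) → PAState P → Prop
  | step (p p' : LProc Sg Role) (PS : Multiset (LProc Sg Role)) (IK IK' : Set (Cls P.E))
      (a : Label Role (Cls P.E)) :
      LPStep P p IK a p' IK' → PAStep P ⟨p ::ₘ PS, IK⟩ a ⟨p' ::ₘ PS, IK'⟩
  | new (ro : Role) (p' : LProc Sg Role) (PS : Multiset (LProc Sg Role)) (IK IK' : Set (Cls P.E))
      (a : Label Role (Cls P.E)) :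
      LPStep P ⟨ro, maxProcId PS ro + 1, 1,
        (P.proc ro).map (Term.subst (freshSubst ro (maxProcId PS ro + 1)))⟩ IK a p' IK' →
      PAStep P ⟨PS, IK⟩ a ⟨p' ::ₘ PS, IK'⟩

/-- `PARuns P α s`: the initial process state reaches `s` by the label sequence `α`. -/
inductive PARuns [DecidableEq Role] (P : Protocol Sg Role) :
    List (Label Role (Cls P.E)) → PAState P → Prop
  | init : PARuns P [] ⟨0, ∅⟩
  | step (α : List (Label Role (Cls P.E))) (a : Label Role (Cls P.E)) (s s' : PAState P) :
      PARuns P α s → PAStep P s a s' → PARuns P (α ++ [a]) s'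

/-! ## Constrained forwards strand semantics -/

/-- A labeled ground strand `(ro, i) [u₁, …, uₖ]`: the part that was already executed. -/
structure GStrand (P : Protocol Sg Role) where
  role : Role
  id : ℕ
  msgs : List (SMsg (Cls P.E))

/-- Ground strand states. -/
structure FWState (P : Protocol Sg Role) where
  strands : Multiset (GStrand P)
  ik : Set (Cls P.E)

/-- The initial state: no strands, empty intruder knowledge. -/
def FWState.init (P : Protocol Sg Role) : FWState P := ⟨0, ∅⟩

def maxStrId [DecidableEq Role] {P : Protocol Sg Role} (SS : Multiset (GStrand P))
    (ro : Role) : ℕ :=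
  ((SS.filter fun s => s.role = ro).map GStrand.id).sup

/-- The `E`-class of the instance of a list of strand messages. -/
def inst (E : Set (Term Sg Role × Term Sg Role)) (τ : Var Sg → Term Sg Role)
    (L : List (SMsg (Term Sg Role))) : List (SMsg (Cls E)) :=
  L.map (SMsg.map fun t => cls E (t.subst τ))

/-- A ground substitution that extends the fresh substitution `ρ_{ro,i}`. -/
def SessionSubst (ro : Role) (i : ℕ) (τ : Var Sg → Term Sg Role) : Prop :=
  IsGroundSubst τ ∧ ∀ x : Var Sg, x.sort = Sg.fresh → τ x = .name x.idx ro i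

/-- Forward transitions.  In every rule `(ro, L ++ u :: L')` is a strand of the specification.  One
ground substitution `τ` comprises the match of the executed part `L`, the fresh substitution
`ρ_{ro,i}`, and the choice of ground values for the choice variables of `u`. -/
inductive FWStep [DecidableEq Role] (P : Protocol Sg Role) :
    FWState P → Label Role (Cls P.E) → FWState P → Prop
  | sendLearn (ro : Role) (i : ℕ) (L L' : List (SMsg (Term Sg Role))) (M : Term Sg Role)
      (τ : Var Sg → Term Sg Role) (SS : Multiset (GStrand P)) (IK : Set (Cls P.E)) :
      (ro, L ++ .send M :: L') ∈ P.strandSpec → L ≠ [] → SessionSubst ro i τ →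
      cls P.E (M.subst τ) ∉ IK →
      FWStep P ⟨⟨ro, i, inst P.E τ L⟩ ::ₘ SS, IK⟩
        ⟨ro, i, L.length + 1, .learn (cls P.E (M.subst τ)), 0⟩
        ⟨⟨ro, i, inst P.E τ (L ++ [.send M])⟩ ::ₘ SS, insert (cls P.E (M.subst τ)) IK⟩
  | send (ro : Role) (i : ℕ) (L L' : List (SMsg (Term Sg Role))) (M : Term Sg Role)
      (τ : Var Sg → Term Sg Role) (SS : Multiset (GStrand P)) (IK : Set (Cls P.E)) :
      (ro, L ++ .send M :: L') ∈ P.strandSpec → L ≠ [] → SessionSubst ro i τ →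
      FWStep P ⟨⟨ro, i, inst P.E τ L⟩ ::ₘ SS, IK⟩
        ⟨ro, i, L.length + 1, .send (cls P.E (M.subst τ)), 0⟩
        ⟨⟨ro, i, inst P.E τ (L ++ [.send M])⟩ ::ₘ SS, IK⟩
  | sendLearnNew (ro : Role) (L' : List (SMsg (Term Sg Role))) (M : Term Sg Role)
      (τ : Var Sg → Term Sg Role) (SS : Multiset (GStrand P)) (IK : Set (Cls P.E)) :
      (ro, .send M :: L') ∈ P.strandSpec → SessionSubst ro (maxStrId SS ro + 1) τ →
      cls P.E (M.subst τ) ∉ IK →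
      FWStep P ⟨SS, IK⟩ ⟨ro, maxStrId SS ro + 1, 1, .learn (cls P.E (M.subst τ)), 0⟩
        ⟨⟨ro, maxStrId SS ro + 1, inst P.E τ [.send M]⟩ ::ₘ SS, insert (cls P.E (M.subst τ)) IK⟩
  | sendNew (ro : Role) (L' : List (SMsg (Term Sg Role))) (M : Term Sg Role)
      (τ : Var Sg → Term Sg Role) (SS : Multiset (GStrand P)) (IK : Set (Cls P.E)) :
      (ro, .send M :: L') ∈ P.strandSpec → SessionSubst ro (maxStrId SS ro + 1) τ →
      FWStep P ⟨SS, IK⟩ ⟨ro, maxStrId SS ro + 1, 1, .send (cls P.E (M.subst τ)), 0⟩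
        ⟨⟨ro, maxStrId SS ro + 1, inst P.E τ [.send M]⟩ ::ₘ SS, IK⟩
  | recv (ro : Role) (i : ℕ) (L L' : List (SMsg (Term Sg Role))) (M : Term Sg Role)
      (τ : Var Sg → Term Sg Role) (SS : Multiset (GStrand P)) (IK : Set (Cls P.E)) :
      (ro, L ++ .recv M :: L') ∈ P.strandSpec → L ≠ [] → SessionSubst ro i τ →
      cls P.E (M.subst τ) ∈ IK →
      FWStep P ⟨⟨ro, i, inst P.E τ L⟩ ::ₘ SS, IK⟩
        ⟨ro, i, L.length + 1, .recv (cls P.E (M.subst τ)), 0⟩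
        ⟨⟨ro, i, inst P.E τ (L ++ [.recv M])⟩ ::ₘ SS, IK⟩
  | recvNew (ro : Role) (L' : List (SMsg (Term Sg Role))) (M : Term Sg Role)
      (τ : Var Sg → Term Sg Role) (SS : Multiset (GStrand P)) (IK : Set (Cls P.E)) :
      (ro, .recv M :: L') ∈ P.strandSpec → SessionSubst ro (maxStrId SS ro + 1) τ →
      cls P.E (M.subst τ) ∈ IK →
      FWStep P ⟨SS, IK⟩ ⟨ro, maxStrId SS ro + 1, 1, .recv (cls P.E (M.subst τ)), 0⟩
        ⟨⟨ro, maxStrId SS ro + 1, inst P.E τ [.recv M]⟩ ::ₘ SS, IK⟩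
  | cond (ro : Role) (i : ℕ) (L L' : List (SMsg (Term Sg Role))) (T : Cond (Term Sg Role)) (n : ℕ)
      (τ : Var Sg → Term Sg Role) (SS : Multiset (GStrand P)) (IK : Set (Cls P.E)) :
      (ro, L ++ .cond T n :: L') ∈ P.strandSpec → L ≠ [] → SessionSubst ro i τ →
      (T.map fun t => cls P.E (t.subst τ)).Holds →
      FWStep P ⟨⟨ro, i, inst P.E τ L⟩ ::ₘ SS, IK⟩
        ⟨ro, i, L.length + 1, .det, n⟩
        ⟨⟨ro, i, inst P.E τ (L ++ [.cond T n])⟩ ::ₘ SS, IK⟩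
  | any (ro : Role) (i : ℕ) (L L' : List (SMsg (Term Sg Role))) (n : ℕ)
      (τ : Var Sg → Term Sg Role) (SS : Multiset (GStrand P)) (IK : Set (Cls P.E)) :
      (ro, L ++ .any n :: L') ∈ P.strandSpec → L ≠ [] → SessionSubst ro i τ →
      FWStep P ⟨⟨ro, i, inst P.E τ L⟩ ::ₘ SS, IK⟩
        ⟨ro, i, L.length + 1, .any, n⟩
        ⟨⟨ro, i, inst P.E τ (L ++ [.any n])⟩ ::ₘ SS, IK⟩
  | anyNew (ro : Role) (L' : List (SMsg (Term Sg Role))) (n : ℕ)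
      (SS : Multiset (GStrand P)) (IK : Set (Cls P.E)) :
      (ro, .any n :: L') ∈ P.strandSpec →
      FWStep P ⟨SS, IK⟩ ⟨ro, maxStrId SS ro + 1, 1, .any, n⟩
        ⟨⟨ro, maxStrId SS ro + 1, [.any n]⟩ ::ₘ SS, IK⟩

/-- `FWRuns P α s`: the initial strand state reaches `s` by the label sequence `α`. -/
inductive FWRuns [DecidableEq Role] (P : Protocol Sg Role) :
    List (Label Role (Cls P.E)) → FWState P → Prop
  | init : FWRuns P [] (FWState.init P)
  | step (α : List (Label Role (Cls P.E))) (a : Label Role (Cls P.E)) (s s' : FWState P) :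
      FWRuns P α s → FWStep P s a s' → FWRuns P (α ++ [a]) s'

/-- The relation `H`: both states are reachable, by the same label sequence. -/
def RelH [DecidableEq Role] (P : Protocol Sg Role) (Pst : PAState P) (Fst : FWState P) : Prop :=
  ∃ α, PARuns P α Pst ∧ FWRuns P α Fst

/-! ## Symbolic strand states

Lists of strand messages (associative, identity `nil`) are lists, and the unions `&` and `,`
(associative, commutative, with identity) are multisets; an element is either proper (`inl`) or a
variable (`inr n`) of the sort of lists, strand sets or sets of intruder facts. -/

/-- A strand `[past | future]`. -/
structure Strand (α : Type*) where
  past : List (SMsg α ⊕ ℕ)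
  future : List (SMsg α ⊕ ℕ)

/-- Intruder facts `m ∈ I` and `m ∉ I`. -/
inductive Fact (α : Type*)
  | known (m : α) : Fact α
  | unknown (m : α) : Fact α

def Fact.map {α β : Type*} (f : α → β) : Fact α → Fact β
  | .known m => .known (f m)
  | .unknown m => .unknown (f m)

def Fact.msg {α : Type*} : Fact α → α
  | .known m => m
  | .unknown m => m

structure SState (α : Type*) where
  strands : Multiset (Strand α ⊕ ℕ)
  ik : Multiset (Fact α ⊕ ℕ)

section maps
variable {α β : Type*}

def mapList (f : α → β) (l : List (SMsg α ⊕ ℕ)) : List (SMsg β ⊕ ℕ) :=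
  l.map (Sum.map (SMsg.map f) id)

def Strand.map (f : α → β) (s : Strand α) : Strand β := ⟨mapList f s.past, mapList f s.future⟩

def mapStrands (f : α → β) (A : Multiset (Strand α ⊕ ℕ)) : Multiset (Strand β ⊕ ℕ) :=
  A.map (Sum.map (Strand.map f) id)

def mapIk (f : α → β) (A : Multiset (Fact α ⊕ ℕ)) : Multiset (Fact β ⊕ ℕ) :=
  A.map (Sum.map (Fact.map f) id)

def SState.map (f : α → β) (S : SState α) : SState β := ⟨mapStrands f S.strands, mapIk f S.ik⟩

end maps

/-- Variables of all kinds: message variables, and variables for lists of strand messages, for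
sets of strands and for sets of intruder facts. -/
inductive SVar (Sg : Signature.{u, v})
  | msg (x : Var Sg) : SVar Sg
  | lst (n : ℕ) : SVar Sg
  | sset (n : ℕ) : SVar Sg
  | ik (n : ℕ) : SVar Sg

/-- Substitutions for all kinds of variables; see `SSubst.Sorted` for their well-sortedness. -/
structure SSubst (Sg : Signature.{u, v}) (Role : Type w) where
  msg : Var Sg → Term Sg Role
  lst : ℕ → List (SMsg (Term Sg Role) ⊕ ℕ)
  sset : ℕ → Multiset (Strand (Term Sg Role) ⊕ ℕ)
  ik : ℕ → Multiset (Fact (Term Sg Role) ⊕ ℕ)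

namespace SSubst

def id : SSubst Sg Role :=
  ⟨.var, fun n => [.inr n], fun n => {.inr n}, fun n => {.inr n}⟩

def onList (σ : SSubst Sg Role) (l : List (SMsg (Term Sg Role) ⊕ ℕ)) :
    List (SMsg (Term Sg Role) ⊕ ℕ) :=
  l.flatMap (Sum.elim (fun m => [.inl (m.map (Term.subst σ.msg))]) σ.lst)

def onStrand (σ : SSubst Sg Role) (s : Strand (Term Sg Role)) : Strand (Term Sg Role) :=
  ⟨σ.onList s.past, σ.onList s.future⟩

def onStrands (σ : SSubst Sg Role) (A : Multiset (Strand (Term Sg Role) ⊕ ℕ)) :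
    Multiset (Strand (Term Sg Role) ⊕ ℕ) :=
  A.bind (Sum.elim (fun s => {.inl (σ.onStrand s)}) σ.sset)

def onIk (σ : SSubst Sg Role) (A : Multiset (Fact (Term Sg Role) ⊕ ℕ)) :
    Multiset (Fact (Term Sg Role) ⊕ ℕ) :=
  A.bind (Sum.elim (fun f => {.inl (f.map (Term.subst σ.msg))}) σ.ik)

def onState (σ : SSubst Sg Role) (S : SState (Term Sg Role)) : SState (Term Sg Role) :=
  ⟨σ.onStrands S.strands, σ.onIk S.ik⟩

def onPair (σ : SSubst Sg Role) (p : Term Sg Role × Term Sg Role) : Term Sg Role × Term Sg Role :=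
  (p.1.subst σ.msg, p.2.subst σ.msg)

/-- First `σ`, then `τ`. -/
def comp (σ τ : SSubst Sg Role) : SSubst Sg Role :=
  ⟨fun x => (σ.msg x).subst τ.msg, fun n => τ.onList (σ.lst n), fun n => τ.onStrands (σ.sset n),
    fun n => τ.onIk (σ.ik n)⟩

end SSubst

/-! Well-sortedness of states (all messages have sort `msg`) and of substitutions. -/

def SortedList (l : List (SMsg (Term Sg Role) ⊕ ℕ)) : Prop :=
  ∀ m, Sum.inl m ∈ l → ∀ t ∈ m.msgs, HasSort t Sg.msg

def SortedStrands (A : Multiset (Strand (Term Sg Role) ⊕ ℕ)) : Prop :=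
  ∀ s, Sum.inl s ∈ A → SortedList s.past ∧ SortedList s.future

def SortedIk (A : Multiset (Fact (Term Sg Role) ⊕ ℕ)) : Prop :=
  ∀ f, Sum.inl f ∈ A → HasSort f.msg Sg.msg

def SState.Sorted (S : SState (Term Sg Role)) : Prop := SortedStrands S.strands ∧ SortedIk S.ik

def SSubst.Sorted (σ : SSubst Sg Role) : Prop :=
  IsSubst σ.msg ∧ (∀ n, SortedList (σ.lst n)) ∧ (∀ n, SortedStrands (σ.sset n)) ∧
    ∀ n, SortedIk (σ.ik n)

/-! Variables. -/

def varsList (l : List (SMsg (Term Sg Role) ⊕ ℕ)) : Set (SVar Sg) :=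
  ⋃ e ∈ l, Sum.elim (fun m => SVar.msg '' msgVars m.msgs) (fun n => {SVar.lst n}) e

def varsStrands (A : Multiset (Strand (Term Sg Role) ⊕ ℕ)) : Set (SVar Sg) :=
  ⋃ e ∈ A, Sum.elim (fun s => varsList s.past ∪ varsList s.future) (fun n => {SVar.sset n}) e

def varsIk (A : Multiset (Fact (Term Sg Role) ⊕ ℕ)) : Set (SVar Sg) :=
  ⋃ e ∈ A, Sum.elim (fun f => SVar.msg '' f.msg.vars) (fun n => {SVar.ik n}) e

def SState.vars (S : SState (Term Sg Role)) : Set (SVar Sg) := varsStrands S.strands ∪ varsIk S.ik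

def pairVars (p : Term Sg Role × Term Sg Role) : Set (SVar Sg) :=
  SVar.msg '' (p.1.vars ∪ p.2.vars)

/-- The value of `σ` at `x` is `x` itself. -/
def SSubst.Fixes (σ : SSubst Sg Role) : SVar Sg → Prop
  | .msg x => σ.msg x = .var x
  | .lst n => σ.lst n = [.inr n]
  | .sset n => σ.sset n = {.inr n}
  | .ik n => σ.ik n = {.inr n}

/-- The variables of the value of `σ` at a variable. -/
def SSubst.varsAt (σ : SSubst Sg Role) : SVar Sg → Set (SVar Sg)
  | .msg x => SVar.msg '' (σ.msg x).vars
  | .lst n => varsList (σ.lst n)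
  | .sset n => varsStrands (σ.sset n)
  | .ik n => varsIk (σ.ik n)

/-- `σ` and `ρ` have values equal modulo `E` at a variable. -/
def SSubst.EqAt (E : Set (Term Sg Role × Term Sg Role)) (σ ρ : SSubst Sg Role) : SVar Sg → Prop
  | .msg x => cls E (σ.msg x) = cls E (ρ.msg x)
  | .lst n => mapList (cls E) (σ.lst n) = mapList (cls E) (ρ.lst n)
  | .sset n => mapStrands (cls E) (σ.sset n) = mapStrands (cls E) (ρ.sset n)
  | .ik n => mapIk (cls E) (σ.ik n) = mapIk (cls E) (ρ.ik n)

/-! ## Complete sets of unifiers -/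

/-- `σ` is a unifier of `S = S'` modulo `E` (and the axioms of lists and unions). -/
def IsUnifier (E : Set (Term Sg Role × Term Sg Role)) (S S' : SState (Term Sg Role))
    (σ : SSubst Sg Role) : Prop :=
  σ.Sorted ∧ (σ.onState S).map (cls E) = (σ.onState S').map (cls E)

/-- `U` is a complete set of unifiers of `S = S'` away from `W`. -/
structure IsCSU (E : Set (Term Sg Role × Term Sg Role)) (S S' : SState (Term Sg Role))
    (W : Set (SVar Sg)) (U : Set (SSubst Sg Role)) : Prop where
  unifier : ∀ σ ∈ U, IsUnifier E S S' σ
  complete : ∀ ρ, IsUnifier E S S' ρ →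
    ∃ σ ∈ U, ∃ τ : SSubst Sg Role, τ.Sorted ∧ ∀ x ∈ W, (σ.comp τ).EqAt E ρ x
  dom : ∀ σ ∈ U, ∀ x, ¬ σ.Fixes x → x ∈ S.vars ∪ S'.vars
  range : ∀ σ ∈ U, ∀ x, ¬ σ.Fixes x → Disjoint (σ.varsAt x) W

/-- A complete unification procedure: for all unification problems between states and all finite
sets `W` of variables that contain those of the problem, it yields a complete set of unifiers away
from `W`. -/
def IsUnificationProcedure (E : Set (Term Sg Role × Term Sg Role))
    (csu : SState (Term Sg Role) → SState (Term Sg Role) → Set (SVar Sg) → Set (SSubst Sg Role)) :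
    Prop :=
  ∀ S S' W, S.Sorted → S'.Sorted → W.Finite → S.vars ∪ S'.vars ⊆ W → IsCSU E S S' W (csu S S' W)

/-! ## Constrained backwards strand semantics -/

/-- A backwards rule `⟨lhs, Ψ⟩ → ⟨rhs, Ψ ∧ diseq⟩`, where `diseq` is either absent or one
disequality `M ≠ M'`; in the latter case the resulting constraint has to be satisfiable. -/
structure Rule (Sg : Signature.{u, v}) (Role : Type w) where
  lhs : SState (Term Sg Role)
  rhs : SState (Term Sg Role)
  diseq : Option (Term Sg Role × Term Sg Role)

def Rule.vars (R : Rule Sg Role) : Set (SVar Sg) :=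
  R.lhs.vars ∪ R.rhs.vars ∪ ⋃ p ∈ R.diseq, pairVars p

/-- Sort-preserving renamings of variables. -/
structure Renaming (Sg : Signature.{u, v}) where
  msg : Var Sg → Var Sg
  lst : ℕ → ℕ
  sset : ℕ → ℕ
  ik : ℕ → ℕ
  msg_sort : ∀ x, (msg x).sort = x.sort
  msg_inj : Function.Injective msg
  lst_inj : Function.Injective lst
  sset_inj : Function.Injective sset
  ik_inj : Function.Injective ik

def Renaming.toSubst (ν : Renaming Sg) : SSubst Sg Role :=
  ⟨fun x => .var (ν.msg x), fun n => [.inr (ν.lst n)], fun n => {.inr (ν.sset n)},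
    fun n => {.inr (ν.ik n)}⟩

def Rule.rename (ν : Renaming Sg) (R : Rule Sg Role) : Rule Sg Role :=
  ⟨ν.toSubst.onState R.lhs, ν.toSubst.onState R.rhs, R.diseq.map ν.toSubst.onPair⟩

/-- The message variables `M` (for `k = 0`) and `M'` (for `k = 1`) of the rules. -/
def ruleVar (k : ℕ) : Term Sg Role := .var ⟨Sg.msg, k⟩

/-- `{ SS & [L, u | L'] & {F, IK} }`, for variables `SS`, `L`, `L'`, `IK` and a multiset `F` of
facts. -/
def afterPat (u : SMsg (Term Sg Role)) (F : Multiset (Fact (Term Sg Role))) :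
    SState (Term Sg Role) :=
  ⟨{.inr 0, .inl ⟨[.inr 0, .inl u], [.inr 1]⟩}, F.map .inl + {.inr 0}⟩

/-- `{ SS & [L | u, L'] & {F, IK} }`. -/
def beforePat (u : SMsg (Term Sg Role)) (F : Multiset (Fact (Term Sg Role))) :
    SState (Term Sg Role) :=
  ⟨{.inr 0, .inl ⟨[.inr 0], [.inl u, .inr 1]⟩}, F.map .inl + {.inr 0}⟩

/-- The backwards rules of a protocol, already oriented backwards. -/
inductive BWRule (P : Protocol Sg Role) : Rule Sg Role → Prop
  /-- receiving a message -/
  | recv : BWRule P ⟨afterPat (.recv (ruleVar 0)) {.known (ruleVar 0)},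
      beforePat (.recv (ruleVar 0)) {.known (ruleVar 0)}, none⟩
  /-- sending a message that the intruder does not learn -/
  | send : BWRule P ⟨afterPat (.send (ruleVar 0)) 0, beforePat (.send (ruleVar 0)) 0, none⟩
  /-- sending a message that the intruder learns -/
  | sendLearn : BWRule P ⟨afterPat (.send (ruleVar 0)) {.known (ruleVar 0)},
      beforePat (.send (ruleVar 0)) {.unknown (ruleVar 0)}, none⟩
  /-- learning a message from a new strand of the protocol -/
  | newStrand (ro : Role) (l₁ l₂ : List (SMsg (Term Sg Role))) (M : Term Sg Role) :
      (ro, l₁ ++ .send M :: l₂) ∈ P.strandSpec →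
      BWRule P ⟨⟨{.inr 0}, {.inl (.known M), .inr 0}⟩,
        ⟨{.inr 0, .inl ⟨l₁.map .inl, .inl (.send M) :: l₂.map .inl⟩},
          {.inl (.unknown M), .inr 0}⟩, none⟩
  /-- explicit nondeterministic choice -/
  | any (n : ℕ) : BWRule P ⟨afterPat (.any n) 0, beforePat (.any n) 0, none⟩
  /-- equality constraint -/
  | condEq (n : ℕ) : BWRule P ⟨afterPat (.cond (.eq (ruleVar 0) (ruleVar 0)) n) 0,
      beforePat (.cond (.eq (ruleVar 0) (ruleVar 0)) n) 0, none⟩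
  /-- disequality constraint -/
  | condNe (n : ℕ) : BWRule P ⟨afterPat (.cond (.ne (ruleVar 0) (ruleVar 1)) n) 0,
      beforePat (.cond (.ne (ruleVar 0) (ruleVar 1)) n) 0, some (ruleVar 0, ruleVar 1)⟩

/-- A constrained state `⟨S, Ψ⟩`; `Ψ` is a conjunction of disequalities `u ≠ v`, given by the
pairs `(u, v)`. -/
structure CState (Sg : Signature.{u, v}) (Role : Type w) where
  st : SState (Term Sg Role)
  cstr : Multiset (Term Sg Role × Term Sg Role)

def CState.vars (C : CState Sg Role) : Set (SVar Sg) := C.st.vars ∪ ⋃ p ∈ C.cstr, pairVars p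

/-- `Ψσ` holds modulo `E`. -/
def SatBy (E : Set (Term Sg Role × Term Sg Role)) (Ψ : Multiset (Term Sg Role × Term Sg Role))
    (σ : Var Sg → Term Sg Role) : Prop :=
  ∀ p ∈ Ψ, ¬ EqE E (p.1.subst σ) (p.2.subst σ)

/-- `Ψ` is satisfiable in the free algebra of terms (with variables) modulo `E`. -/
def Satisfiable (E : Set (Term Sg Role × Term Sg Role))
    (Ψ : Multiset (Term Sg Role × Term Sg Role)) : Prop :=
  ∃ σ : Var Sg → Term Sg Role, IsSubst σ ∧ SatBy E Ψ σ

/-- One backwards narrowing step with unifier `σ`: a backwards rule, renamed apart from a finite set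
`W` that contains the variables of the state, is applied at the top of the state. -/
inductive NarrowStep (P : Protocol Sg Role)
    (csu : SState (Term Sg Role) → SState (Term Sg Role) → Set (SVar Sg) → Set (SSubst Sg Role)) :
    CState Sg Role → SSubst Sg Role → CState Sg Role → Prop
  | step (C : CState Sg Role) (W : Set (SVar Sg)) (R R' : Rule Sg Role) (ν : Renaming Sg)
      (σ : SSubst Sg Role) (Ψ : Multiset (Term Sg Role × Term Sg Role)) :
      W.Finite → C.vars ⊆ W → BWRule P R → R' = R.rename ν → Disjoint R'.vars W →
      σ ∈ csu C.st R'.lhs (W ∪ R'.vars) →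
      Ψ = (C.cstr + (R'.diseq.elim 0 fun p => {p})).map σ.onPair →
      (R'.diseq.isSome → Satisfiable P.E Ψ) →
      NarrowStep P csu C σ ⟨σ.onState R'.rhs, Ψ⟩

/-- Backwards narrowing sequences; the substitution is the composition of the unifiers. -/
inductive Narrows (P : Protocol Sg Role)
    (csu : SState (Term Sg Role) → SState (Term Sg Role) → Set (SVar Sg) → Set (SSubst Sg Role)) :
    CState Sg Role → SSubst Sg Role → CState Sg Role → Prop
  | refl (C : CState Sg Role) : Narrows P csu C SSubst.id C
  | head (C C' C'' : CState Sg Role) (σ μ : SSubst Sg Role) :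
      NarrowStep P csu C σ C' → Narrows P csu C' μ C'' → Narrows P csu C (σ.comp μ) C''

/-- Constrained symbolic strand states of `P`: every strand is, modulo `E`, an instance of a strand
of the specification, and there are variables `SS` for further strands and `IK` for further
intruder facts.  As complete sets of unifiers need not be minimal, a union of several such variables
may stand in the place of one. -/
structure IsSymbolicState (P : Protocol Sg Role) (C : CState Sg Role) : Prop where
  sorted : C.st.Sorted
  cstr_sorted : ∀ p ∈ C.cstr, HasSort p.1 Sg.msg ∧ HasSort p.2 Sg.msg
  strand : ∀ s, Sum.inl s ∈ C.st.strands → ∃ p f : List (SMsg (Term Sg Role)),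
    s = ⟨p.map .inl, f.map .inl⟩ ∧ ∃ (ro : Role) (m : List (SMsg (Term Sg Role)))
      (ρ : Var Sg → Term Sg Role), (ro, m) ∈ P.strandSpec ∧ IsSubst ρ ∧
      inst P.E ρ m = (p ++ f).map (SMsg.map (cls P.E))
  has_SS : ∃ n, Sum.inr n ∈ C.st.strands
  has_IK : ∃ n, Sum.inr n ∈ C.st.ik

/-- Initial symbolic states: the bar is at the beginning of all strands, and there is no fact of the
form `m ∈ I`. -/
def IsInitial (C : CState Sg Role) : Prop :=
  (∀ s, Sum.inl s ∈ C.st.strands → s.past = []) ∧ ∀ m, Sum.inl (Fact.known m) ∉ C.st.ik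

/-- `C >^θ s`: the constrained state `C` instantiates to the ground state `s` by the ground
substitution `θ`.  A strand with empty past is matched by the empty strand, which is left implicit
in ground states. -/
structure Lifts (P : Protocol Sg Role) (C : CState Sg Role) (θ : Var Sg → Term Sg Role)
    (s : FWState P) : Prop where
  ground : IsGroundSubst θ
  strand : ∀ (p : List (SMsg (Term Sg Role))) (f : List (SMsg (Term Sg Role) ⊕ ℕ)),
    Sum.inl ⟨p.map .inl, f⟩ ∈ C.st.strands → p ≠ [] → ∃ g ∈ s.strands, g.msgs = inst P.E θ p
  known : ∀ m, Sum.inl (Fact.known m) ∈ C.st.ik → cls P.E (m.subst θ) ∈ s.ik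
  unknown : ∀ m, Sum.inl (Fact.unknown m) ∈ C.st.ik → cls P.E (m.subst θ) ∉ s.ik
  cstr : SatBy P.E C.cstr θ

end MNPA

namespace MNPA

variable {Sg : Signature.{u, v}} {Role : Type w} {E : Set (Term Sg Role × Term Sg Role)}

/-! ## Substitutions on terms and on classes -/

/-! The forward run that reaches `Fst` is undone step by step. The invariant is `Represents C θ s`:
modulo `E`, the instance of `C` by `θ` has only pasts that are empty or executed in `s`, facts that
are true in `s`, and disequalities that hold between classes with ground representatives. A forward
step extends one strand `q` by one message `x` and possibly adds one sent message `m` to the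
knowledge (`FWStep.exists_extends`).

One forward step may correspond to several narrowing steps, because several symbolic strands may
share the ground strand `q ++ [x]` and several facts may assert that `m` is known.
`Extends.exists_narrows` counts the strands and facts that fail in the earlier state and removes
them one at a time. For a failing strand the bar is moved back over `x` (`exists_narrowStep_bar`).
For a failing fact the rule for new strands replaces it by its negation and adds a strand with past
`q` (`exists_narrowStep_new`). A learning send is therefore treated as a send that is not learnt
and, separately, a fact explained by a new strand. A receive rule needs a fact that its message is
known, which the symbolic state may lack; the instance chosen for unification puts it into the
variable for further facts, and it is true because the receive was executable.

A ground match becomes narrowing by the lifting argument in `exists_narrowStep`: an instance `b` of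
the state and an instance `k` of a rule, equal modulo `E`, form one unifier after renaming apart. It
factors modulo `E` as a computed unifier `σ` followed by some `τ`, and `τ` gives the instance of the
new state. `exists_narrowStep_symbolic` shows that the new state is again symbolic although `σ`
comes from an arbitrary complete set. Since `τ` may give values to set variables, its message part
only yields a submultiset of the expected instance, which is enough for the invariant.

The factor `τ` need not be ground, and a term equal modulo `E` to a ground term may contain
variables. Hence `θ` is not required to be ground, and disequalities carry ground representatives
instead. At the initial state all variables are replaced by ground terms; this fixes the classes of
those representatives, so the disequalities survive (`Represents.exists_lifts`). -/

theorem cls_eq_iff {t t' : Term Sg Role} : cls E t = cls E t' ↔ EqE E t t' :=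
  Quotient.eq (r := eqSetoid E)

theorem Term.subst_subst (σ τ : Var Sg → Term Sg Role) (t : Term Sg Role) :
    (t.subst σ).subst τ = t.subst fun x => (σ x).subst τ := by
  induction t with
  | var x => rfl
  | name r ro i => rfl
  | app f args ih => simp only [Term.subst, ih]

theorem Term.subst_var (t : Term Sg Role) : t.subst .var = t := by
  induction t with
  | var x => rfl
  | name r ro i => rfl
  | app f args ih => simp only [Term.subst, ih]

theorem Term.subst_congr {σ τ : Var Sg → Term Sg Role} {t : Term Sg Role}
    (h : ∀ x ∈ t.vars, σ x = τ x) : t.subst σ = t.subst τ := by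
  induction t with
  | var x => exact h x rfl
  | name r ro i => rfl
  | app f args ih =>
    simp only [Term.subst]
    congr 1
    funext k
    exact ih k fun x hx => h x (Set.mem_iUnion.2 ⟨k, hx⟩)

theorem Term.Ground.subst {t : Term Sg Role} (h : t.Ground) (σ : Var Sg → Term Sg Role) :
    t.subst σ = t := by
  rw [Term.subst_congr (τ := .var) fun x hx => by rw [h] at hx; exact hx.elim, t.subst_var]

theorem Term.mem_vars_subst {σ : Var Sg → Term Sg Role} {t : Term Sg Role} {y : Var Sg}
    (h : y ∈ (t.subst σ).vars) : ∃ x ∈ t.vars, y ∈ (σ x).vars := by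
  induction t with
  | var x => exact ⟨x, rfl, h⟩
  | name r ro i => exact h.elim
  | app f args ih =>
    obtain ⟨k, hk⟩ := Set.mem_iUnion.1 h
    obtain ⟨x, hx, hy⟩ := ih k hk
    exact ⟨x, Set.mem_iUnion.2 ⟨k, hx⟩, hy⟩

theorem Term.ground_subst {τ : Var Sg → Term Sg Role} (hτ : ∀ x, (τ x).Ground)
    (t : Term Sg Role) : (t.subst τ).Ground :=
  Set.eq_empty_of_forall_notMem fun _ hy => by
    obtain ⟨x, -, hx⟩ := Term.mem_vars_subst hy
    rw [hτ x] at hx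
    exact hx

theorem Term.finite_vars (t : Term Sg Role) : t.vars.Finite := by
  induction t with
  | var x => exact Set.finite_singleton x
  | name r ro i => exact Set.finite_empty
  | app f args ih => exact Set.finite_iUnion ih

theorem HasSort.subst {t : Term Sg Role} {s : Sg.Srt} (h : HasSort t s)
    {σ : Var Sg → Term Sg Role} (hσ : IsSubst σ) : HasSort (t.subst σ) s := by
  induction h with
  | var x => exact hσ x
  | name r ro i => exact .name r ro i
  | app f ss s args hd _ ih => exact .app f ss s _ hd ih
  | sub t s s' _ hle ih => exact .sub _ s s' ih hle

theorem IsSubst.comp {σ τ : Var Sg → Term Sg Role} (hσ : IsSubst σ) (hτ : IsSubst τ) :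
    IsSubst fun x => (σ x).subst τ := fun x => (hσ x).subst hτ

theorem isSubst_var : IsSubst (Term.var : Var Sg → Term Sg Role) := HasSort.var

/-- Substitutions that agree modulo `E` on the variables of a sorted term have the same effect. -/
theorem HasSort.cls_subst_congr {t : Term Sg Role} {s : Sg.Srt} (h : HasSort t s)
    {σ τ : Var Sg → Term Sg Role} (hσ : IsSubst σ) (hτ : IsSubst τ)
    (heq : ∀ x ∈ t.vars, cls E (σ x) = cls E (τ x)) :
    cls E (t.subst σ) = cls E (t.subst τ) := by
  induction h with
  | var x => exact heq x rfl
  | name r ro i => rfl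
  | app f ss s args hd hs ih =>
    -- Congruence in `EqE` needs both argument tuples sorted at one declaration of `f`; this is why
    -- the induction runs over the sort derivation and not over the term.
    exact cls_eq_iff.2 (.congr f ss s _ _ hd (fun k => (hs k).subst hσ) (fun k => (hs k).subst hτ)
      fun k => cls_eq_iff.1 (ih k fun x hx => heq x (Set.mem_iUnion.2 ⟨k, hx⟩)))
  | sub t s s' _ _ ih => exact ih heq

theorem EqE.subst {t t' : Term Sg Role} (h : EqE E t t') {σ : Var Sg → Term Sg Role}
    (hσ : IsSubst σ) : EqE E (t.subst σ) (t'.subst σ) := by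
  induction h with
  | refl t => exact .refl _
  | symm t t' _ ih => exact .symm _ _ ih
  | trans t t' t'' _ _ ih ih' => exact .trans _ _ _ ih ih'
  | ax l r τ hlr hτ =>
    rw [Term.subst_subst, Term.subst_subst]
    exact .ax l r _ hlr (hτ.comp hσ)
  | congr f ss s a b hd ha hb _ ih =>
    exact .congr f ss s _ _ hd (fun k => (ha k).subst hσ) (fun k => (hb k).subst hσ) ih

/-- The action of a substitution on classes. -/
def Cls.subst {σ : Var Sg → Term Sg Role} (hσ : IsSubst σ) : Cls E → Cls E :=
  Quotient.map' (s₁ := eqSetoid E) (s₂ := eqSetoid E) (Term.subst σ) fun _ _ h => EqE.subst h hσ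

theorem Cls.subst_cls {σ : Var Sg → Term Sg Role} (hσ : IsSubst σ) (t : Term Sg Role) :
    Cls.subst hσ (cls E t) = cls E (t.subst σ) := rfl

/-- The class of an instance. -/
def cview (E : Set (Term Sg Role × Term Sg Role)) (θ : Var Sg → Term Sg Role)
    (t : Term Sg Role) : Cls E := cls E (t.subst θ)

/-! ## Functoriality -/

section maps
variable {α β γ : Type*}

theorem Cond.map_map (f : α → β) (g : β → γ) (c : Cond α) :
    (c.map f).map g = c.map (g ∘ f) := by cases c <;> rfl

theorem SMsg.map_map (f : α → β) (g : β → γ) (m : SMsg α) :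
    (m.map f).map g = m.map (g ∘ f) := by
  cases m <;> simp [SMsg.map, Cond.map_map]

theorem SMsg.map_congr {f g : α → β} {m : SMsg α} (h : ∀ t ∈ m.msgs, f t = g t) :
    m.map f = m.map g := by
  rcases m with a | a | n | ⟨a, b⟩ | ⟨a, b⟩ <;>
    simp_all [SMsg.map, SMsg.msgs, Cond.map, Cond.msgs]

theorem SMsg.mem_msgs_map {f : α → β} {m : SMsg α} {b : β} (h : b ∈ (m.map f).msgs) :
    ∃ a ∈ m.msgs, b = f a := by
  rcases m with a | a | n | ⟨a, b⟩ | ⟨a, b⟩ <;>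
    simp_all [SMsg.map, SMsg.msgs, Cond.map, Cond.msgs]

theorem Fact.map_map (f : α → β) (g : β → γ) (m : Fact α) :
    (m.map f).map g = m.map (g ∘ f) := by cases m <;> rfl

theorem Fact.map_congr {f g : α → β} {m : Fact α} (h : f m.msg = g m.msg) :
    m.map f = m.map g := by
  cases m <;> simp_all [Fact.map, Fact.msg]

theorem Fact.msg_map (f : α → β) (m : Fact α) : (m.map f).msg = f m.msg := by cases m <;> rfl

theorem mapList_append (f : α → β) (l l' : List (SMsg α ⊕ ℕ)) :
    mapList f (l ++ l') = mapList f l ++ mapList f l' := List.map_append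

theorem mapList_inl (f : α → β) (l : List (SMsg α)) :
    mapList f (l.map .inl) = (l.map (SMsg.map f)).map .inl := by
  simp [mapList, Function.comp_def]

theorem mapList_mapList (f : α → β) (g : β → γ) (l : List (SMsg α ⊕ ℕ)) :
    mapList g (mapList f l) = mapList (g ∘ f) l := by
  simp only [mapList, List.map_map]
  refine List.map_congr_left fun e _ => ?_
  cases e <;> simp [SMsg.map_map]

theorem Strand.map_map (f : α → β) (g : β → γ) (s : Strand α) :
    (s.map f).map g = s.map (g ∘ f) := by
  simp [Strand.map, mapList_mapList]

/-- Mapping messages keeps list variables and proper elements apart, so the absence of list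
variables can be read off modulo `E`. -/
theorem eq_map_inl_of_mapList {f : α → β} {l : List (SMsg α ⊕ ℕ)} {q : List (SMsg β)}
    (h : mapList f l = q.map .inl) :
    ∃ p : List (SMsg α), l = p.map .inl ∧ p.map (SMsg.map f) = q := by
  induction l generalizing q with
  | nil => exact ⟨[], rfl, by cases q <;> simp_all [mapList]⟩
  | cons e l ih =>
    cases q with
    | nil => simp [mapList] at h
    | cons a q =>
      cases e with
      | inr n => simp [mapList] at h
      | inl m =>
        simp only [mapList, List.map_cons, List.cons.injEq, Sum.map_inl, Sum.inl.injEq] at h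
        obtain ⟨p, rfl, hp⟩ := ih h.2
        exact ⟨m :: p, rfl, by simp [h.1, hp]⟩

/-- The proper elements of a union. -/
def lefts (A : Multiset (α ⊕ ℕ)) : Multiset α := A.filterMap Sum.getLeft?

@[simp] theorem lefts_zero : lefts (0 : Multiset (α ⊕ ℕ)) = 0 := rfl

@[simp] theorem lefts_cons_inl (a : α) (A : Multiset (α ⊕ ℕ)) :
    lefts (.inl a ::ₘ A) = a ::ₘ lefts A := by simp [lefts]

@[simp] theorem lefts_cons_inr (n : ℕ) (A : Multiset (α ⊕ ℕ)) :
    lefts (.inr n ::ₘ A) = lefts A :=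
  Multiset.filterMap_cons_none _ _ rfl

@[simp] theorem lefts_singleton_inl (a : α) : lefts {(.inl a : α ⊕ ℕ)} = {a} := by
  rw [← Multiset.cons_zero, lefts_cons_inl]; rfl

@[simp] theorem lefts_singleton_inr (n : ℕ) : lefts {(.inr n : α ⊕ ℕ)} = 0 := by
  rw [← Multiset.cons_zero, lefts_cons_inr]; rfl

@[simp] theorem lefts_add (A B : Multiset (α ⊕ ℕ)) : lefts (A + B) = lefts A + lefts B := by
  induction A using Multiset.induction with
  | empty => simp
  | cons e A ih => cases e <;> simp [ih]

@[simp] theorem mem_lefts {a : α} {A : Multiset (α ⊕ ℕ)} : a ∈ lefts A ↔ .inl a ∈ A := by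
  simp [lefts]

@[simp] theorem lefts_map_inl (F : Multiset α) : lefts (F.map (.inl : α → α ⊕ ℕ)) = F := by
  induction F using Multiset.induction with
  | empty => simp
  | cons e A ih => simp [ih]

theorem lefts_map (f : α → β) (A : Multiset (α ⊕ ℕ)) :
    lefts (A.map (Sum.map f id)) = (lefts A).map f := by
  induction A using Multiset.induction with
  | empty => simp
  | cons e A ih => cases e <;> simp [ih]

theorem inl_mem_map {f : α → β} {A : Multiset (α ⊕ ℕ)} {a : α} (h : .inl a ∈ A) :
    .inl (f a) ∈ A.map (Sum.map f id) := Multiset.mem_map_of_mem (Sum.map f id) h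

theorem inr_mem_map {f : α → β} {A : Multiset (α ⊕ ℕ)} {n : ℕ} :
    .inr n ∈ A.map (Sum.map f id) ↔ .inr n ∈ A := by
  simp

end maps

/-! ## Substitutions on states -/

namespace SSubst

@[ext] theorem ext' {σ τ : SSubst Sg Role} (h₁ : ∀ x, σ.msg x = τ.msg x)
    (h₂ : ∀ n, σ.lst n = τ.lst n) (h₃ : ∀ n, σ.sset n = τ.sset n) (h₄ : ∀ n, σ.ik n = τ.ik n) :
    σ = τ := by
  cases σ; cases τ
  simp only [SSubst.mk.injEq]
  exact ⟨funext h₁, funext h₂, funext h₃, funext h₄⟩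

variable (σ τ : SSubst Sg Role)

@[simp] theorem onList_nil : σ.onList [] = [] := rfl

@[simp] theorem onList_cons_inl (m : SMsg (Term Sg Role)) (l : List (SMsg (Term Sg Role) ⊕ ℕ)) :
    σ.onList (.inl m :: l) = .inl (m.map (Term.subst σ.msg)) :: σ.onList l := rfl

@[simp] theorem onList_cons_inr (n : ℕ) (l : List (SMsg (Term Sg Role) ⊕ ℕ)) :
    σ.onList (.inr n :: l) = σ.lst n ++ σ.onList l := rfl

@[simp] theorem onList_append (l l' : List (SMsg (Term Sg Role) ⊕ ℕ)) :
    σ.onList (l ++ l') = σ.onList l ++ σ.onList l' := List.flatMap_append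

theorem onList_inl (l : List (SMsg (Term Sg Role))) :
    σ.onList (l.map .inl) = (l.map (SMsg.map (Term.subst σ.msg))).map .inl := by
  induction l with
  | nil => rfl
  | cons m l ih => simp [ih]

@[simp] theorem onStrands_zero : σ.onStrands 0 = 0 := rfl

@[simp] theorem onStrands_cons_inl (s : Strand (Term Sg Role))
    (A : Multiset (Strand (Term Sg Role) ⊕ ℕ)) :
    σ.onStrands (.inl s ::ₘ A) = .inl (σ.onStrand s) ::ₘ σ.onStrands A := by
  simp [onStrands]

@[simp] theorem onStrands_cons_inr (n : ℕ) (A : Multiset (Strand (Term Sg Role) ⊕ ℕ)) :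
    σ.onStrands (.inr n ::ₘ A) = σ.sset n + σ.onStrands A := by
  simp [onStrands]

@[simp] theorem onStrands_singleton_inl (s : Strand (Term Sg Role)) :
    σ.onStrands {.inl s} = {.inl (σ.onStrand s)} := by
  simp [onStrands]

@[simp] theorem onStrands_singleton_inr (n : ℕ) : σ.onStrands {.inr n} = σ.sset n := by
  simp [onStrands]

@[simp] theorem onStrands_add (A B : Multiset (Strand (Term Sg Role) ⊕ ℕ)) :
    σ.onStrands (A + B) = σ.onStrands A + σ.onStrands B := by
  simp [onStrands]

@[simp] theorem onIk_zero : σ.onIk 0 = 0 := rfl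

@[simp] theorem onIk_cons_inl (s : Fact (Term Sg Role))
    (A : Multiset (Fact (Term Sg Role) ⊕ ℕ)) :
    σ.onIk (.inl s ::ₘ A) = .inl (s.map (Term.subst σ.msg)) ::ₘ σ.onIk A := by
  simp [onIk]

@[simp] theorem onIk_cons_inr (n : ℕ) (A : Multiset (Fact (Term Sg Role) ⊕ ℕ)) :
    σ.onIk (.inr n ::ₘ A) = σ.ik n + σ.onIk A := by
  simp [onIk]

@[simp] theorem onIk_singleton_inr (n : ℕ) : σ.onIk {.inr n} = σ.ik n := by
  simp [onIk]

@[simp] theorem onIk_add (A B : Multiset (Fact (Term Sg Role) ⊕ ℕ)) :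
    σ.onIk (A + B) = σ.onIk A + σ.onIk B := by
  simp [onIk]

@[simp] theorem onIk_map_inl (F : Multiset (Fact (Term Sg Role))) :
    σ.onIk (F.map .inl) = (F.map (Fact.map (Term.subst σ.msg))).map .inl := by
  induction F using Multiset.induction with
  | empty => simp
  | cons e A ih => simp [ih]

theorem comp_onList (l : List (SMsg (Term Sg Role) ⊕ ℕ)) :
    (σ.comp τ).onList l = τ.onList (σ.onList l) := by
  induction l with
  | nil => rfl
  | cons e l ih =>
    cases e with
    | inl m =>
      simp only [onList_cons_inl, ih, SMsg.map_map]
      congr 3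
      funext t
      exact (Term.subst_subst σ.msg τ.msg t).symm
    | inr n => rw [onList_cons_inr, onList_cons_inr, onList_append, ← ih]; rfl

theorem comp_onStrand (s : Strand (Term Sg Role)) :
    (σ.comp τ).onStrand s = τ.onStrand (σ.onStrand s) := by
  simp [onStrand, comp_onList]

theorem comp_onStrands (A : Multiset (Strand (Term Sg Role) ⊕ ℕ)) :
    (σ.comp τ).onStrands A = τ.onStrands (σ.onStrands A) := by
  induction A using Multiset.induction with
  | empty => simp
  | cons e A ih =>
    cases e with
    | inl m => simp [ih, comp_onStrand]
    | inr n => rw [onStrands_cons_inr, onStrands_cons_inr, onStrands_add, ← ih]; rfl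

theorem comp_onIk (A : Multiset (Fact (Term Sg Role) ⊕ ℕ)) :
    (σ.comp τ).onIk A = τ.onIk (σ.onIk A) := by
  induction A using Multiset.induction with
  | empty => simp
  | cons e A ih =>
    cases e with
    | inl m =>
      simp only [onIk_cons_inl, ih, Fact.map_map]
      congr 3
      funext t
      exact (Term.subst_subst σ.msg τ.msg t).symm
    | inr n => rw [onIk_cons_inr, onIk_cons_inr, onIk_add, ← ih]; rfl

theorem comp_onState (S : SState (Term Sg Role)) :
    (σ.comp τ).onState S = τ.onState (σ.onState S) := by
  simp [onState, comp_onStrands, comp_onIk]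

variable {σ τ}

/-! Sorts. -/

theorem Sorted.onList (hσ : σ.Sorted) {l : List (SMsg (Term Sg Role) ⊕ ℕ)} (hl : SortedList l) :
    SortedList (σ.onList l) := by
  intro m hm t ht
  obtain ⟨e, he, hme⟩ := List.mem_flatMap.1 hm
  cases e with
  | inl m' =>
    obtain rfl := Sum.inl_injective (List.mem_singleton.1 hme)
    obtain ⟨a, ha, rfl⟩ := SMsg.mem_msgs_map ht
    exact (hl m' he a ha).subst hσ.1
  | inr n => exact hσ.2.1 n m hme t ht

theorem Sorted.onStrands (hσ : σ.Sorted) {A : Multiset (Strand (Term Sg Role) ⊕ ℕ)}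
    (hA : SortedStrands A) : SortedStrands (σ.onStrands A) := by
  intro s hs
  obtain ⟨e, he, hse⟩ := Multiset.mem_bind.1 hs
  cases e with
  | inl s' =>
    obtain rfl := Sum.inl_injective (Multiset.mem_singleton.1 hse)
    exact ⟨hσ.onList (hA s' he).1, hσ.onList (hA s' he).2⟩
  | inr n => exact hσ.2.2.1 n s hse

theorem Sorted.onIk (hσ : σ.Sorted) {A : Multiset (Fact (Term Sg Role) ⊕ ℕ)}
    (hA : SortedIk A) : SortedIk (σ.onIk A) := by
  intro s hs
  obtain ⟨e, he, hse⟩ := Multiset.mem_bind.1 hs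
  cases e with
  | inl s' =>
    obtain rfl := Sum.inl_injective (Multiset.mem_singleton.1 hse)
    rw [Fact.msg_map]
    exact (hA s' he).subst hσ.1
  | inr n => exact hσ.2.2.2 n s hse

theorem Sorted.onState (hσ : σ.Sorted) {S : SState (Term Sg Role)} (hS : S.Sorted) :
    (σ.onState S).Sorted := ⟨hσ.onStrands hS.1, hσ.onIk hS.2⟩

/-! Substitutions that agree modulo `E` on the variables. -/

theorem mapList_congr (hσ : σ.Sorted) (hτ : τ.Sorted) {l : List (SMsg (Term Sg Role) ⊕ ℕ)}
    (hl : SortedList l) (h : ∀ x ∈ varsList l, σ.EqAt E τ x) :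
    mapList (cls E) (σ.onList l) = mapList (cls E) (τ.onList l) := by
  induction l with
  | nil => rfl
  | cons e l ih =>
    have ih' := ih (fun m hm => hl m (List.mem_cons_of_mem _ hm)) fun x hx => h x (by
      simp only [varsList, Set.mem_iUnion, exists_prop] at hx ⊢
      obtain ⟨e, he, hx⟩ := hx
      exact ⟨e, List.mem_cons_of_mem _ he, hx⟩)
    cases e with
    | inr n =>
      simp only [onList_cons_inr, mapList_append, ih']
      congr 1
      exact h (.lst n) (by simp [varsList])
    | inl m =>
      simp only [onList_cons_inl]
      change Sum.inl _ :: mapList _ _ = Sum.inl _ :: mapList _ _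
      rw [ih', SMsg.map_map, SMsg.map_map]
      congr 2
      refine SMsg.map_congr fun t ht => ?_
      refine (hl m (by simp) t ht).cls_subst_congr hσ.1 hτ.1 fun x hx => h (.msg x) ?_
      simp only [varsList, Set.mem_iUnion, exists_prop]
      exact ⟨.inl m, by simp, x, Set.mem_biUnion ht hx, rfl⟩

theorem mapStrands_congr (hσ : σ.Sorted) (hτ : τ.Sorted)
    {A : Multiset (Strand (Term Sg Role) ⊕ ℕ)} (hA : SortedStrands A)
    (h : ∀ x ∈ varsStrands A, σ.EqAt E τ x) :
    mapStrands (cls E) (σ.onStrands A) = mapStrands (cls E) (τ.onStrands A) := by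
  simp only [mapStrands, onStrands, Multiset.map_bind]
  refine Multiset.bind_congr fun e he => ?_
  have hsub : ∀ x ∈ Sum.elim (fun s => varsList s.past ∪ varsList s.future)
      (fun n => {SVar.sset n}) e, σ.EqAt E τ x := fun x hx => h x (by
        simp only [varsStrands, Set.mem_iUnion, exists_prop]
        exact ⟨e, he, hx⟩)
  cases e with
  | inr n => exact hsub (.sset n) rfl
  | inl s =>
    simp only [Sum.elim_inl, Multiset.map_singleton, Sum.map_inl]
    congr 2
    simp only [Strand.map, onStrand, Strand.mk.injEq]
    exact ⟨mapList_congr hσ hτ (hA s he).1 fun x hx => hsub x (.inl hx),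
      mapList_congr hσ hτ (hA s he).2 fun x hx => hsub x (.inr hx)⟩

theorem mapIk_congr (hσ : σ.Sorted) (hτ : τ.Sorted)
    {A : Multiset (Fact (Term Sg Role) ⊕ ℕ)} (hA : SortedIk A)
    (h : ∀ x ∈ varsIk A, σ.EqAt E τ x) :
    mapIk (cls E) (σ.onIk A) = mapIk (cls E) (τ.onIk A) := by
  simp only [mapIk, onIk, Multiset.map_bind]
  refine Multiset.bind_congr fun e he => ?_
  have hsub : ∀ x ∈ Sum.elim (fun f : Fact (Term Sg Role) => SVar.msg '' f.msg.vars)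
      (fun n => {SVar.ik n}) e, σ.EqAt E τ x := fun x hx => h x (by
        simp only [varsIk, Set.mem_iUnion, exists_prop]
        exact ⟨e, he, hx⟩)
  cases e with
  | inr n => exact hsub (.ik n) rfl
  | inl f =>
    simp only [Sum.elim_inl, Multiset.map_singleton, Sum.map_inl, Fact.map_map]
    congr 2
    exact Fact.map_congr ((hA f he).cls_subst_congr hσ.1 hτ.1 fun x hx =>
      hsub (.msg x) ⟨x, hx, rfl⟩)

/-- A complete set of unifiers only promises a factorization modulo `E` on a finite set of
variables; this turns that promise into equality of whole instances. -/
theorem map_onState_congr (hσ : σ.Sorted) (hτ : τ.Sorted) {S : SState (Term Sg Role)}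
    (hS : S.Sorted) (h : ∀ x ∈ S.vars, σ.EqAt E τ x) :
    (σ.onState S).map (cls E) = (τ.onState S).map (cls E) := by
  simp only [SState.map, onState, SState.mk.injEq]
  exact ⟨mapStrands_congr hσ hτ hS.1 fun x hx => h x (.inl hx),
    mapIk_congr hσ hτ hS.2 fun x hx => h x (.inr hx)⟩

/-! The variables of instances. -/

variable {T : Set (SVar Sg)}

/-- The bound `T` will be the set of variables with index at least `N`, which shows that a shifted
rule is disjoint from the state. -/
theorem varsMsg_subset (hσ : ∀ x, σ.varsAt x ⊆ T) (t : Term Sg Role) :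
    SVar.msg '' (t.subst σ.msg).vars ⊆ T := by
  rintro _ ⟨y, hy, rfl⟩
  obtain ⟨x, -, hx⟩ := Term.mem_vars_subst hy
  exact hσ (.msg x) ⟨y, hx, rfl⟩

theorem varsList_onList_subset (hσ : ∀ x, σ.varsAt x ⊆ T) (l : List (SMsg (Term Sg Role) ⊕ ℕ)) :
    varsList (σ.onList l) ⊆ T := by
  refine Set.iUnion₂_subset fun e he => ?_
  obtain ⟨e', -, hee⟩ := List.mem_flatMap.1 he
  cases e' with
  | inr n =>
    refine Set.Subset.trans ?_ (hσ (.lst n))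
    exact Set.subset_biUnion_of_mem (u := fun e => Sum.elim _ _ e) hee
  | inl m =>
    obtain rfl := List.mem_singleton.1 hee
    rintro _ ⟨y, hy, rfl⟩
    obtain ⟨t, ht, hy⟩ := Set.mem_iUnion₂.1 hy
    obtain ⟨a, -, rfl⟩ := SMsg.mem_msgs_map ht
    exact varsMsg_subset hσ a ⟨y, hy, rfl⟩

theorem vars_onState_subset (hσ : ∀ x, σ.varsAt x ⊆ T) (S : SState (Term Sg Role)) :
    (σ.onState S).vars ⊆ T := by
  refine Set.union_subset (Set.iUnion₂_subset fun e he => ?_) (Set.iUnion₂_subset fun e he => ?_)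
  · obtain ⟨e', -, hee⟩ := Multiset.mem_bind.1 he
    cases e' with
    | inr n =>
      refine Set.Subset.trans ?_ (hσ (.sset n))
      exact Set.subset_biUnion_of_mem (u := fun e => Sum.elim _ _ e) hee
    | inl s =>
      obtain rfl := Multiset.mem_singleton.1 hee
      exact Set.union_subset (varsList_onList_subset hσ _) (varsList_onList_subset hσ _)
  · obtain ⟨e', -, hee⟩ := Multiset.mem_bind.1 he
    cases e' with
    | inr n =>
      refine Set.Subset.trans ?_ (hσ (.ik n))
      exact Set.subset_biUnion_of_mem (u := fun e => Sum.elim _ _ e) hee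
    | inl f =>
      obtain rfl := Multiset.mem_singleton.1 hee
      simp only [Sum.elim_inl, Fact.msg_map]
      exact varsMsg_subset hσ _

theorem pairVars_onPair_subset (hσ : ∀ x, σ.varsAt x ⊆ T) (p : Term Sg Role × Term Sg Role) :
    pairVars (σ.onPair p) ⊆ T := by
  rw [pairVars, Set.image_union]
  exact Set.union_subset (varsMsg_subset hσ _) (varsMsg_subset hσ _)

end SSubst

theorem SMsg.finite_msgs {α : Type*} (m : SMsg α) : m.msgs.Finite := by
  rcases m with a | a | n | ⟨a, b⟩ | ⟨a, b⟩ <;> simp [SMsg.msgs, Cond.msgs]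

theorem finite_varsList (l : List (SMsg (Term Sg Role) ⊕ ℕ)) : (varsList l).Finite := by
  refine Set.Finite.biUnion (List.finite_toSet l) fun e _ => ?_
  cases e with
  | inr n => exact Set.finite_singleton _
  | inl m => exact (m.finite_msgs.biUnion fun t _ => t.finite_vars).image _

theorem SState.finite_vars (S : SState (Term Sg Role)) : S.vars.Finite := by
  classical
  refine Set.Finite.union ?_ ?_
  · refine Set.Finite.biUnion (Multiset.finite_toSet S.strands) fun e _ => ?_
    cases e with
    | inr n => exact Set.finite_singleton _
    | inl s => exact (finite_varsList _).union (finite_varsList _)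
  · refine Set.Finite.biUnion (Multiset.finite_toSet S.ik) fun e _ => ?_
    cases e with
    | inr n => exact Set.finite_singleton _
    | inl f => exact f.msg.finite_vars.image _

theorem finite_pairVars (p : Term Sg Role × Term Sg Role) : (pairVars p).Finite :=
  (p.1.finite_vars.union p.2.finite_vars).image _

theorem CState.finite_vars (C : CState Sg Role) : C.vars.Finite := by
  classical
  exact C.st.finite_vars.union
    (Set.Finite.biUnion (Multiset.finite_toSet C.cstr) fun p _ => finite_pairVars p)

theorem Rule.finite_vars (R : Rule Sg Role) : R.vars.Finite := by
  refine (R.lhs.finite_vars.union R.rhs.finite_vars).union (Set.Finite.biUnion ?_ fun p _ =>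
    finite_pairVars p)
  -- The members of an option form the preimage of a singleton under the injection `some`.
  exact (Set.finite_singleton R.diseq).preimage (Option.some_injective _).injOn |>.subset
    fun p hp => Eq.symm hp

/-! ## Views of a symbolic state under a substitution of messages -/

/-- The strands of an instance, modulo `E`. -/
def strandView (E : Set (Term Sg Role × Term Sg Role)) (θ : Var Sg → Term Sg Role)
    (S : SState (Term Sg Role)) : Multiset (Strand (Cls E)) :=
  (lefts S.strands).map (Strand.map (cview E θ))

/-- The intruder facts of an instance, modulo `E`. -/
def factView (E : Set (Term Sg Role × Term Sg Role)) (θ : Var Sg → Term Sg Role)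
    (S : SState (Term Sg Role)) : Multiset (Fact (Cls E)) :=
  (lefts S.ik).map (Fact.map (cview E θ))

def pairView (E : Set (Term Sg Role × Term Sg Role)) (θ : Var Sg → Term Sg Role)
    (p : Term Sg Role × Term Sg Role) : Cls E × Cls E := (cview E θ p.1, cview E θ p.2)

theorem satBy_iff {Ψ : Multiset (Term Sg Role × Term Sg Role)} {σ : Var Sg → Term Sg Role} :
    SatBy E Ψ σ ↔ ∀ q ∈ Ψ.map (pairView E σ), q.1 ≠ q.2 := by
  simp only [SatBy, Multiset.mem_map, forall_exists_index, and_imp, forall_apply_eq_imp_iff₂]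
  exact forall₂_congr fun p _ => not_congr cls_eq_iff.symm

theorem cls_comp_subst (θ : Var Sg → Term Sg Role) : cls E ∘ Term.subst θ = cview E θ := rfl

/-- Without list variables only the message part of `τ` acts on the strand. -/
theorem map_onStrand_of_proper (τ : SSubst Sg Role) {s : Strand (Term Sg Role)}
    {p f : List (SMsg (Term Sg Role))} (hs : s = ⟨p.map .inl, f.map .inl⟩) :
    (τ.onStrand s).map (cls E) = s.map (cview E τ.msg) := by
  have key (l : List (SMsg (Term Sg Role))) :
      mapList (cls E) (τ.onList (l.map .inl)) = mapList (cview E τ.msg) (l.map .inl) := by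
    rw [SSubst.onList_inl, ← mapList_inl, mapList_mapList]
    rfl
  subst hs
  rw [Strand.map, Strand.map, SSubst.onStrand, key, key]

/-- The inequality can be strict: the values of `τ` at set variables may contain proper strands,
which the left-hand side ignores. -/
theorem map_strands_le (τ : SSubst Sg Role) {A : Multiset (Strand (Term Sg Role) ⊕ ℕ)}
    (hA : ∀ s, .inl s ∈ A → ∃ p f : List (SMsg (Term Sg Role)), s = ⟨p.map .inl, f.map .inl⟩) :
    (lefts A).map (Strand.map (cview E τ.msg)) ≤ lefts (mapStrands (cls E) (τ.onStrands A)) := by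
  rw [mapStrands, lefts_map]
  induction A using Multiset.induction with
  | empty => simp
  | cons e A ih =>
    have ih' := ih fun s hs => hA s (Multiset.mem_cons_of_mem hs)
    cases e with
    | inl s =>
      obtain ⟨p, f, hs⟩ := hA s (Multiset.mem_cons_self _ _)
      simpa [map_onStrand_of_proper τ hs] using ih'
    | inr n => simpa using ih'.trans (Multiset.le_add_left _ _)

theorem map_strands_eq (τ : SSubst Sg Role) (hτ : ∀ n, τ.sset n = {.inr n})
    {A : Multiset (Strand (Term Sg Role) ⊕ ℕ)}
    (hA : ∀ s, .inl s ∈ A → ∃ p f : List (SMsg (Term Sg Role)), s = ⟨p.map .inl, f.map .inl⟩) :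
    lefts (mapStrands (cls E) (τ.onStrands A)) = (lefts A).map (Strand.map (cview E τ.msg)) := by
  rw [mapStrands, lefts_map]
  induction A using Multiset.induction with
  | empty => simp
  | cons e A ih =>
    have ih' := ih fun s hs => hA s (Multiset.mem_cons_of_mem hs)
    cases e with
    | inl s =>
      obtain ⟨p, f, hs⟩ := hA s (Multiset.mem_cons_self _ _)
      simpa [map_onStrand_of_proper τ hs] using ih'
    | inr n => simpa [hτ] using ih'

theorem map_facts_le (τ : SSubst Sg Role) (A : Multiset (Fact (Term Sg Role) ⊕ ℕ)) :
    (lefts A).map (Fact.map (cview E τ.msg)) ≤ lefts (mapIk (cls E) (τ.onIk A)) := by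
  rw [mapIk, lefts_map]
  induction A using Multiset.induction with
  | empty => simp
  | cons e A ih =>
    cases e with
    | inl s => simpa [Fact.map_map, cls_comp_subst] using ih
    | inr n => simpa using ih.trans (Multiset.le_add_left _ _)

theorem inr_of_mem_onStrands {τ : SSubst Sg Role} {A : Multiset (Strand (Term Sg Role) ⊕ ℕ)}
    {n : ℕ} (h : .inr n ∈ τ.onStrands A) : ∃ m, .inr m ∈ A := by
  obtain ⟨e, he, hn⟩ := Multiset.mem_bind.1 h
  cases e with
  | inl s => simp at hn
  | inr m => exact ⟨m, he⟩

theorem inr_of_mem_onIk {τ : SSubst Sg Role} {A : Multiset (Fact (Term Sg Role) ⊕ ℕ)}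
    {n : ℕ} (h : .inr n ∈ τ.onIk A) : ∃ m, .inr m ∈ A := by
  obtain ⟨e, he, hn⟩ := Multiset.mem_bind.1 h
  cases e with
  | inl s => simp at hn
  | inr m => exact ⟨m, he⟩

/-! ## Renaming apart -/

def SVar.index : SVar Sg → ℕ
  | .msg x => x.idx
  | .lst n => n
  | .sset n => n
  | .ik n => n

theorem exists_index_lt {W : Set (SVar Sg)} (hW : W.Finite) : ∃ N, ∀ x ∈ W, x.index < N := by
  obtain ⟨N, hN⟩ := (hW.image SVar.index).bddAbove
  exact ⟨N + 1, fun x hx => Nat.lt_succ_of_le (hN ⟨x, hx, rfl⟩)⟩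

/-- The renaming that adds `N` to all indices. -/
def Renaming.shift (N : ℕ) : Renaming Sg where
  msg x := ⟨x.sort, x.idx + N⟩
  lst n := n + N
  sset n := n + N
  ik n := n + N
  msg_sort _ := rfl
  msg_inj := by
    rintro ⟨s, i⟩ ⟨s', i'⟩ h
    simp only [Var.mk.injEq, Nat.add_right_cancel_iff] at h ⊢
    exact h
  lst_inj := fun _ _ => Nat.add_right_cancel
  sset_inj := fun _ _ => Nat.add_right_cancel
  ik_inj := fun _ _ => Nat.add_right_cancel

theorem Renaming.toSubst_sorted (ν : Renaming Sg) : (ν.toSubst (Role := Role)).Sorted := by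
  refine ⟨fun x => ?_, fun n m h => ?_, fun n m h => ?_, fun n m h => ?_⟩
  · rw [← ν.msg_sort x]
    exact .var _
  all_goals simp [toSubst] at h

theorem Renaming.varsAt_shift (N : ℕ) (x : SVar Sg) :
    ((shift N).toSubst (Role := Role)).varsAt x ⊆ {y | N ≤ y.index} := by
  cases x <;>
    simp [SSubst.varsAt, toSubst, shift, SVar.index, Term.vars, varsList, varsStrands, varsIk]

/-- `b` on the variables with index below `N`, and `k`, shifted by `N`, on the others. -/
def SSubst.join (N : ℕ) (b k : SSubst Sg Role) : SSubst Sg Role where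
  msg x := if x.idx < N then b.msg x else k.msg ⟨x.sort, x.idx - N⟩
  lst n := if n < N then b.lst n else k.lst (n - N)
  sset n := if n < N then b.sset n else k.sset (n - N)
  ik n := if n < N then b.ik n else k.ik (n - N)

theorem SSubst.join_sorted {N : ℕ} {b k : SSubst Sg Role} (hb : b.Sorted) (hk : k.Sorted) :
    (join N b k).Sorted := by
  refine ⟨fun x => ?_, fun n => ?_, fun n => ?_, fun n => ?_⟩ <;> simp only [join] <;> split_ifs
  · exact hb.1 x
  · exact hk.1 ⟨x.sort, _⟩
  · exact hb.2.1 n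
  · exact hk.2.1 _
  · exact hb.2.2.1 n
  · exact hk.2.2.1 _
  · exact hb.2.2.2 n
  · exact hk.2.2.2 _

/-- Shifted indices are at least `N`, so `join` uses its second branch there and its subtraction
cancels the shift exactly. -/
theorem SSubst.shift_comp_join (N : ℕ) (b k : SSubst Sg Role) :
    (Renaming.shift N).toSubst.comp (join N b k) = k := by
  ext1 <;>
    simp [comp, Renaming.toSubst, Renaming.shift, Term.subst, join]

theorem SSubst.join_eqAt {N : ℕ} (b k : SSubst Sg Role) {x : SVar Sg} (hx : x.index < N) :
    (join N b k).EqAt E b x := by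
  cases x <;> simp_all [EqAt, join, SVar.index]

/-! ## Lifting an instance of a rule to a narrowing step -/

def Rule.diseqs (R : Rule Sg Role) : Multiset (Term Sg Role × Term Sg Role) :=
  R.diseq.elim 0 fun p => {p}

theorem Rule.mem_diseqs {R : Rule Sg Role} {p : Term Sg Role × Term Sg Role} :
    p ∈ R.diseqs ↔ R.diseq = some p := by
  obtain ⟨l, r, _ | d⟩ := R <;> simp [diseqs, eq_comm]

theorem Rule.diseqs_rename (ν : Renaming Sg) (R : Rule Sg Role) :
    (R.rename ν).diseqs = R.diseqs.map ν.toSubst.onPair := by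
  obtain ⟨l, r, _ | d⟩ := R <;> simp [diseqs, rename]

/-- All messages of the rule have sort `msg`. -/
structure Rule.Sorted (R : Rule Sg Role) : Prop where
  lhs : R.lhs.Sorted
  rhs : R.rhs.Sorted
  diseqs : ∀ p ∈ R.diseqs, HasSort p.1 Sg.msg ∧ HasSort p.2 Sg.msg

/-- `σ` followed by `τ` is a factorization of the instance `b` of `C` and the instance `k` of a
rule `R` with renamed copy `R'`, and `σ` unifies the state with the left-hand side of `R'`. -/
structure Factorization (E : Set (Term Sg Role × Term Sg Role)) (C : CState Sg Role)
    (R R' : Rule Sg Role) (b k σ τ : SSubst Sg Role) : Prop where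
  left : σ.Sorted
  right : τ.Sorted
  unif : (σ.onState C.st).map (cls E) = (σ.onState R'.lhs).map (cls E)
  eqAt : ∀ x ∈ C.vars, (σ.comp τ).EqAt E b x
  rhs : (τ.onState (σ.onState R'.rhs)).map (cls E) = (k.onState R.rhs).map (cls E)
  cstr : ((C.cstr + R'.diseqs).map σ.onPair).map (pairView E τ.msg) =
    C.cstr.map (pairView E b.msg) + R.diseqs.map (pairView E k.msg)

theorem pairView_onPair (σ τ : SSubst Sg Role) (p : Term Sg Role × Term Sg Role) :
    pairView E τ.msg (σ.onPair p) = pairView E (σ.comp τ).msg p := by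
  simp [pairView, cview, SSubst.onPair, SSubst.comp, Term.subst_subst]

theorem pairView_congr {σ τ : SSubst Sg Role} (hσ : σ.Sorted) (hτ : τ.Sorted)
    {p : Term Sg Role × Term Sg Role} (hp : HasSort p.1 Sg.msg ∧ HasSort p.2 Sg.msg)
    (h : ∀ x ∈ pairVars p, σ.EqAt E τ x) : pairView E σ.msg p = pairView E τ.msg p :=
  Prod.ext (hp.1.cls_subst_congr hσ.1 hτ.1 fun x hx => h (.msg x) ⟨x, .inl hx, rfl⟩)
    (hp.2.cls_subst_congr hσ.1 hτ.1 fun x hx => h (.msg x) ⟨x, .inr hx, rfl⟩)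

theorem SSubst.Sorted.comp {σ τ : SSubst Sg Role} (hσ : σ.Sorted) (hτ : τ.Sorted) :
    (σ.comp τ).Sorted :=
  ⟨IsSubst.comp hσ.1 hτ.1, fun n => hτ.onList (hσ.2.1 n), fun n => hτ.onStrands (hσ.2.2.1 n),
    fun n => hτ.onIk (hσ.2.2.2 n)⟩

theorem SSubst.Sorted.onPair {σ : SSubst Sg Role} (hσ : σ.Sorted)
    {p : Term Sg Role × Term Sg Role} (hp : HasSort p.1 Sg.msg ∧ HasSort p.2 Sg.msg) :
    HasSort (σ.onPair p).1 Sg.msg ∧ HasSort (σ.onPair p).2 Sg.msg :=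
  ⟨hp.1.subst hσ.1, hp.2.subst hσ.1⟩

theorem Rule.Sorted.rename {R : Rule Sg Role} (hR : R.Sorted) (ν : Renaming Sg) :
    (R.rename ν).Sorted := by
  refine ⟨ν.toSubst_sorted.onState hR.lhs, ν.toSubst_sorted.onState hR.rhs, fun p hp => ?_⟩
  rw [diseqs_rename] at hp
  obtain ⟨q, hq, rfl⟩ := Multiset.mem_map.1 hp
  exact ν.toSubst_sorted.onPair (hR.diseqs q hq)

/-- Lifting lemma. Renaming apart lets `b` and `k` be glued into one unifier of the state with the
renamed left-hand side; completeness of the unification procedure factors it through a computed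
unifier. -/
theorem exists_narrowStep {P : Protocol Sg Role}
    {csu : SState (Term Sg Role) → SState (Term Sg Role) → Set (SVar Sg) → Set (SSubst Sg Role)}
    (hcsu : IsUnificationProcedure P.E csu) {C : CState Sg Role} (hC : C.st.Sorted)
    (hC' : ∀ p ∈ C.cstr, HasSort p.1 Sg.msg ∧ HasSort p.2 Sg.msg)
    {R : Rule Sg Role} (hR : BWRule P R) (hRs : R.Sorted) {b k : SSubst Sg Role}
    (hb : b.Sorted) (hk : k.Sorted)
    (hunif : (b.onState C.st).map (cls P.E) = (k.onState R.lhs).map (cls P.E))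
    (hsat : SatBy P.E C.cstr b.msg) (hsat' : SatBy P.E R.diseqs k.msg) :
    ∃ (ν : Renaming Sg) (σ τ : SSubst Sg Role), Factorization P.E C R (R.rename ν) b k σ τ ∧
      NarrowStep P csu C σ
        ⟨σ.onState (R.rename ν).rhs, (C.cstr + (R.rename ν).diseqs).map σ.onPair⟩ := by
  obtain ⟨N, hN⟩ := exists_index_lt C.finite_vars
  set ν : Renaming Sg := Renaming.shift N with hν
  set R' := R.rename ν with hR'
  have hR's : R'.Sorted := hRs.rename ν
  have hR'v : R'.vars ⊆ {y | N ≤ y.index} := by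
    have h := Renaming.varsAt_shift (Sg := Sg) (Role := Role) N
    refine Set.union_subset (Set.union_subset ?_ ?_) (Set.iUnion₂_subset fun p hp => ?_)
    · exact SSubst.vars_onState_subset h _
    · exact SSubst.vars_onState_subset h _
    · obtain ⟨q, -, rfl⟩ := Option.map_eq_some_iff.1 hp
      exact SSubst.pairVars_onPair_subset h q
  have hdisj : Disjoint R'.vars C.vars := Set.disjoint_left.2 fun x hx hx' =>
    absurd (hN x hx') (not_lt.2 (hR'v hx))
  set ρ := SSubst.join N b k
  have hρ : ρ.Sorted := SSubst.join_sorted hb hk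
  have hρb : ∀ x ∈ C.vars, ρ.EqAt P.E b x := fun x hx => SSubst.join_eqAt b k (hN x hx)
  have hρk : ∀ S, ρ.onState (ν.toSubst.onState S) = k.onState S := fun S => by
    rw [← SSubst.comp_onState, SSubst.shift_comp_join]
  have hcsu' := hcsu C.st R'.lhs (C.vars ∪ R'.vars) hC hR's.lhs
    (C.finite_vars.union R'.finite_vars)
    (Set.union_subset_union Set.subset_union_left
      (Set.subset_union_left.trans Set.subset_union_left))
  -- The glued substitution `ρ` acts modulo `E` like `b` on the state and exactly like `k` on the
  -- rule, so `hunif` makes it a unifier.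
  obtain ⟨σ, hσ, τ, hτ, hστ⟩ := hcsu'.complete ρ ⟨hρ, by
    rw [SSubst.map_onState_congr hρ hb hC fun x hx => hρb x (.inl hx), hunif]
    exact congrArg _ (hρk R.lhs).symm⟩
  obtain ⟨hσs, hσu⟩ := hcsu'.unifier σ hσ
  have hcomp := hσs.comp hτ
  have hfac : Factorization P.E C R R' b k σ τ := by
    refine ⟨hσs, hτ, hσu, fun x hx => ?_, ?_, ?_⟩
    · have h1 := hστ x (.inl hx)
      have h2 := hρb x hx
      cases x <;> exact Eq.trans h1 h2
    · rw [← SSubst.comp_onState, SSubst.map_onState_congr hcomp hρ hR's.rhs fun x hx =>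
        hστ x (.inr (.inl (.inr hx)))]
      exact congrArg _ (hρk R.rhs)
    · rw [Multiset.map_add, Multiset.map_add, Multiset.map_map, Multiset.map_map,
        hR', Rule.diseqs_rename, Multiset.map_map]
      congr 1
      · refine Multiset.map_congr rfl fun p hp => ?_
        have hv : pairVars p ⊆ C.vars := fun x hx => .inr (Set.mem_biUnion hp hx)
        rw [Function.comp_apply, pairView_onPair,
          pairView_congr hcomp hρ (hC' p hp) fun x hx => hστ x (.inl (hv hx)),
          pairView_congr hρ hb (hC' p hp) fun x hx => hρb x (hv hx)]
      · refine Multiset.map_congr rfl fun p hp => ?_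
        have hp' : ν.toSubst.onPair p ∈ R'.diseqs := by
          rw [hR', Rule.diseqs_rename]
          exact Multiset.mem_map_of_mem _ hp
        have hv : pairVars (ν.toSubst.onPair p) ⊆ R'.vars := fun x hx =>
          .inr (Set.mem_biUnion (Rule.mem_diseqs.1 hp') hx)
        simp only [Function.comp_apply]
        rw [pairView_onPair, pairView_congr hcomp hρ (hR's.diseqs _ hp')
          fun x hx => hστ x (.inr (hv hx)), pairView_onPair, SSubst.shift_comp_join]
  refine ⟨ν, σ, τ, hfac, .step C C.vars R R' ν σ _ C.finite_vars subset_rfl hR rfl hdisj hσ rfl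
    fun _ => ⟨τ.msg, hτ.1, satBy_iff.2 ?_⟩⟩
  intro q hq
  -- `τ` witnesses satisfiability: its instances of the new disequalities are, as pairs of classes,
  -- those of `b` and of `k`.
  have hq' := hfac.cstr ▸ hq
  rcases Multiset.mem_add.1 hq' with h | h
  · exact satBy_iff.1 hsat q h
  · exact satBy_iff.1 hsat' q h

/-! ## The strands of the specification, modulo `E` -/

/-- `s` is, modulo `E`, an instance of a strand of the specification. -/
def IsSpecStrand (P : Protocol Sg Role) (s : Strand (Cls P.E)) : Prop :=
  ∃ p f : List (SMsg (Cls P.E)), s = ⟨p.map .inl, f.map .inl⟩ ∧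
    ∃ (ro : Role) (m : List (SMsg (Term Sg Role))) (ρ : Var Sg → Term Sg Role),
      (ro, m) ∈ P.strandSpec ∧ IsSubst ρ ∧ inst P.E ρ m = p ++ f

variable {P : Protocol Sg Role}

/-- Being a specification strand depends only on the strand modulo `E`, so it can be carried across
a unification equation, which holds only modulo `E`. -/
theorem isSpecStrand_map_iff {s : Strand (Term Sg Role)} :
    IsSpecStrand P (s.map (cls P.E)) ↔ ∃ p f : List (SMsg (Term Sg Role)),
      s = ⟨p.map .inl, f.map .inl⟩ ∧ ∃ (ro : Role) (m : List (SMsg (Term Sg Role)))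
      (ρ : Var Sg → Term Sg Role), (ro, m) ∈ P.strandSpec ∧ IsSubst ρ ∧
      inst P.E ρ m = (p ++ f).map (SMsg.map (cls P.E)) := by
  constructor
  · rintro ⟨p, f, hs, ro, m, ρ, hm, hρ, heq⟩
    obtain ⟨sp, sf⟩ := s
    simp only [Strand.map, Strand.mk.injEq] at hs
    obtain ⟨p', rfl, rfl⟩ := eq_map_inl_of_mapList hs.1
    obtain ⟨f', rfl, rfl⟩ := eq_map_inl_of_mapList hs.2
    exact ⟨p', f', rfl, ro, m, ρ, hm, hρ, by rw [heq, List.map_append]⟩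
  · rintro ⟨p, f, rfl, ro, m, ρ, hm, hρ, heq⟩
    exact ⟨_, _, by rw [Strand.map, mapList_inl, mapList_inl], ro, m, ρ, hm, hρ,
      by rw [heq, List.map_append]⟩

theorem IsSpecStrand.subst {s : Strand (Cls P.E)} (h : IsSpecStrand P s)
    {σ : Var Sg → Term Sg Role} (hσ : IsSubst σ) : IsSpecStrand P (s.map (Cls.subst hσ)) := by
  obtain ⟨p, f, rfl, ro, m, ρ, hm, hρ, heq⟩ := h
  refine ⟨p.map (SMsg.map (Cls.subst hσ)), f.map (SMsg.map (Cls.subst hσ)),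
    by rw [Strand.map, mapList_inl, mapList_inl], ro, m, _, hm, hρ.comp hσ, ?_⟩
  rw [← List.map_append, ← heq, inst, inst, List.map_map]
  refine List.map_congr_left fun x _ => ?_
  rw [Function.comp_apply, SMsg.map_map]
  congr 1
  funext t
  simp only [Function.comp_apply, Cls.subst_cls, Term.subst_subst]

theorem IsSpecStrand.onStrand {s : Strand (Term Sg Role)}
    (h : IsSpecStrand P (s.map (cls P.E))) {σ : SSubst Sg Role} (hσ : σ.Sorted) :
    IsSpecStrand P ((σ.onStrand s).map (cls P.E)) := by
  obtain ⟨p, f, hs, -⟩ := isSpecStrand_map_iff.1 h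
  rw [map_onStrand_of_proper σ hs]
  have := h.subst hσ.1
  rwa [Strand.map_map] at this

theorem IsSpecStrand.proper {s : Strand (Term Sg Role)}
    (h : IsSpecStrand P (s.map (cls P.E))) :
    ∃ p f : List (SMsg (Term Sg Role)), s = ⟨p.map .inl, f.map .inl⟩ := by
  obtain ⟨p, f, hs, -⟩ := isSpecStrand_map_iff.1 h
  exact ⟨p, f, hs⟩

theorem IsSymbolicState.isSpecStrand {C : CState Sg Role} (hC : IsSymbolicState P C)
    {s : Strand (Term Sg Role)} (hs : .inl s ∈ C.st.strands) :
    IsSpecStrand P (s.map (cls P.E)) := isSpecStrand_map_iff.2 (hC.strand s hs)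

/-! ## Narrowing steps between symbolic states -/

/-- An instance of a backwards rule whose left-hand side is, modulo `E`, an instance of a symbolic
state is lifted to a narrowing step to a symbolic state; the resulting state has an instance that
consists of elements of the instance of the right-hand side. -/
theorem exists_narrowStep_symbolic
    {csu : SState (Term Sg Role) → SState (Term Sg Role) → Set (SVar Sg) → Set (SSubst Sg Role)}
    (hcsu : IsUnificationProcedure P.E csu) {C : CState Sg Role} (hC : IsSymbolicState P C)
    {R : Rule Sg Role} (hR : BWRule P R) (hRs : R.Sorted)
    (hspec : ∀ σ : SSubst Sg Role, σ.Sorted →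
      (∀ s, .inl s ∈ σ.onStrands R.lhs.strands → IsSpecStrand P (s.map (cls P.E))) →
      ∀ s, .inl s ∈ σ.onStrands R.rhs.strands → IsSpecStrand P (s.map (cls P.E)))
    (hSS : ∀ (σ : SSubst Sg Role) (n : ℕ), .inr n ∈ σ.onStrands R.lhs.strands →
      .inr n ∈ σ.onStrands R.rhs.strands)
    (hIK : ∀ (σ : SSubst Sg Role) (n : ℕ), .inr n ∈ σ.onIk R.lhs.ik → .inr n ∈ σ.onIk R.rhs.ik)
    {b k : SSubst Sg Role} (hb : b.Sorted) (hk : k.Sorted)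
    (hbS : ∀ n, b.sset n = {.inr n}) (hbI : ∀ n, .inr n ∈ b.ik n)
    (hunif : (b.onState C.st).map (cls P.E) = (k.onState R.lhs).map (cls P.E))
    (hsat : SatBy P.E C.cstr b.msg) (hsat' : SatBy P.E R.diseqs k.msg) :
    ∃ (C' : CState Sg Role) (σ : SSubst Sg Role) (θ : Var Sg → Term Sg Role),
      NarrowStep P csu C σ C' ∧ IsSymbolicState P C' ∧ IsSubst θ ∧
      strandView P.E θ C'.st ≤ lefts (mapStrands (cls P.E) (k.onStrands R.rhs.strands)) ∧
      factView P.E θ C'.st ≤ lefts (mapIk (cls P.E) (k.onIk R.rhs.ik)) ∧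
      C'.cstr.map (pairView P.E θ) =
        C.cstr.map (pairView P.E b.msg) + R.diseqs.map (pairView P.E k.msg) := by
  obtain ⟨ν, σ, τ, hf, hstep⟩ := exists_narrowStep hcsu hC.sorted hC.cstr_sorted hR hRs hb hk
    hunif hsat hsat'
  have hσ' : (ν.toSubst.comp σ).Sorted := ν.toSubst_sorted.comp hf.left
  have hL : (mapStrands (cls P.E) (σ.onStrands C.st.strands)) =
      mapStrands (cls P.E) ((ν.toSubst.comp σ).onStrands R.lhs.strands) := by
    rw [SSubst.comp_onStrands]
    exact congrArg SState.strands hf.unif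
  have hLk : (mapIk (cls P.E) (σ.onIk C.st.ik)) =
      mapIk (cls P.E) ((ν.toSubst.comp σ).onIk R.lhs.ik) := by
    rw [SSubst.comp_onIk]
    exact congrArg SState.ik hf.unif
  -- Since `b` fixes set variables, the value of `σ` at a set variable of the state collapses to a
  -- single variable under `τ`. It can thus contain no proper strand and must contain a variable.
  have hsset : ∀ n, .inr n ∈ C.st.strands →
      mapStrands (cls P.E) (τ.onStrands (σ.sset n)) = {.inr n} := fun n hn => by
    have := hf.eqAt (.sset n) (.inl (.inl (Set.mem_biUnion hn rfl)))
    refine Eq.trans this ?_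
    rw [hbS]
    rfl
  have hCσ : ∀ s, .inl s ∈ σ.onStrands C.st.strands → IsSpecStrand P (s.map (cls P.E)) := by
    intro s hs
    obtain ⟨e, he, hse⟩ := Multiset.mem_bind.1 hs
    cases e with
    | inl s' =>
      obtain rfl := Sum.inl_injective (Multiset.mem_singleton.1 hse)
      exact (hC.isSpecStrand he).onStrand hf.left
    -- A proper strand in the value of a set variable would remain proper under `τ`, against
    -- `hsset`.
    | inr n =>
      have h1 : Sum.inl (τ.onStrand s) ∈ τ.onStrands (σ.sset n) :=
        Multiset.mem_bind.2 ⟨_, hse, Multiset.mem_singleton_self _⟩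
      have h2 := inl_mem_map (f := Strand.map (cls P.E)) h1
      have h3 := hsset n he
      rw [mapStrands] at h3
      rw [h3] at h2
      simp at h2
  -- The unification equation matches the proper strands on both sides modulo `E`.
  have hlhs : ∀ s, .inl s ∈ (ν.toSubst.comp σ).onStrands R.lhs.strands →
      IsSpecStrand P (s.map (cls P.E)) := by
    intro s hs
    have h := inl_mem_map (f := Strand.map (cls P.E)) hs
    rw [mapStrands, mapStrands] at hL
    rw [← hL] at h
    obtain ⟨e, he, heq⟩ := Multiset.mem_map.1 h
    cases e with
    | inr n => simp at heq
    | inl s' =>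
      have := hCσ s' he
      rwa [Sum.inl_injective heq] at this
  have hrhs := hspec _ hσ' hlhs
  rw [SSubst.comp_onStrands] at hrhs
  have hsorted : (σ.onState (R.rename ν).rhs).Sorted := hf.left.onState (hRs.rename ν).rhs
  refine ⟨_, σ, τ.msg, hstep, ⟨hsorted, fun p hp => ?_,
    fun s hs => isSpecStrand_map_iff.1 (hrhs s hs), ?_, ?_⟩, hf.right.1, ?_, ?_, hf.cstr⟩
  · obtain ⟨q, hq, rfl⟩ := Multiset.mem_map.1 hp
    rcases Multiset.mem_add.1 hq with h | h
    · exact hf.left.onPair (hC.cstr_sorted q h)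
    · exact hf.left.onPair ((hRs.rename ν).diseqs q h)
  · obtain ⟨n, hn⟩ := hC.has_SS
    have h1 : Sum.inr n ∈ mapStrands (cls P.E) (τ.onStrands (σ.sset n)) := by
      rw [hsset n hn]; exact Multiset.mem_singleton_self _
    -- A set variable after applying `τ` can only come from one before it, so the value of `σ`
    -- supplies a variable. The unification equation places it in the left-hand side of the rule,
    -- and `hSS` passes it on to the right-hand side.
    obtain ⟨m, hm⟩ := inr_of_mem_onStrands (inr_mem_map.1 h1)
    have h2 : Sum.inr m ∈ mapStrands (cls P.E) (σ.onStrands C.st.strands) :=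
      inr_mem_map.2 (Multiset.mem_bind.2 ⟨_, hn, hm⟩)
    rw [hL] at h2
    have h3 := hSS _ m (inr_mem_map.1 h2)
    rw [SSubst.comp_onStrands] at h3
    exact ⟨m, h3⟩
  · obtain ⟨n, hn⟩ := hC.has_IK
    have h0 : mapIk (cls P.E) (τ.onIk (σ.ik n)) = mapIk (cls P.E) (b.ik n) :=
      hf.eqAt (.ik n) (.inl (.inr (Set.mem_biUnion hn rfl)))
    -- For fact variables `b` may add proper facts, so one only knows that the variable itself
    -- remains in the value; this suffices.
    have h1 : Sum.inr n ∈ mapIk (cls P.E) (τ.onIk (σ.ik n)) := by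
      rw [h0]; exact inr_mem_map.2 (hbI n)
    obtain ⟨m, hm⟩ := inr_of_mem_onIk (inr_mem_map.1 h1)
    have h2 : Sum.inr m ∈ mapIk (cls P.E) (σ.onIk C.st.ik) :=
      inr_mem_map.2 (Multiset.mem_bind.2 ⟨_, hn, hm⟩)
    rw [hLk] at h2
    have h3 := hIK _ m (inr_mem_map.1 h2)
    rw [SSubst.comp_onIk] at h3
    exact ⟨m, h3⟩
  · have h : mapStrands (cls P.E) (τ.onStrands (σ.onState (R.rename ν).rhs).strands) =
        mapStrands (cls P.E) (k.onStrands R.rhs.strands) := congrArg SState.strands hf.rhs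
    rw [← h]
    exact map_strands_le τ fun s hs => (hrhs s hs).proper
  · have h : mapIk (cls P.E) (τ.onIk (σ.onState (R.rename ν).rhs).ik) =
        mapIk (cls P.E) (k.onIk R.rhs.ik) := congrArg SState.ik hf.rhs
    rw [← h]
    exact map_facts_le τ _

/-! ## Sorts in the strands of a protocol -/

theorem Cond.msgs_neg {α : Type*} (c : Cond α) : c.neg.msgs = c.msgs := by cases c <;> rfl

theorem Proc.msgs_append {α : Type*} (P X : Proc α) : (P.append X).msgs = P.msgs ∪ X.msgs := by
  induction P <;> simp_all [append, msgs, Set.union_assoc, Set.insert_union]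

/-- The accumulator `L` has to be arbitrary because it grows in the recursion; for the specification
it starts empty. Negating a condition does not change its messages. -/
theorem Proc.mem_msgs_of_mem_toStrands {α : Type*} {P : Proc α} {L m : List (SMsg α)}
    (hm : m ∈ P.toStrands L) {x : SMsg α} (hx : x ∈ m) {t : α} (ht : t ∈ x.msgs) :
    t ∈ P.msgs ∨ ∃ y ∈ L, t ∈ y.msgs := by
  induction P, L using Proc.toStrands.induct with
  | case1 L =>
    rw [toStrands] at hm
    obtain rfl := Set.mem_singleton_iff.1 hm
    exact .inr ⟨x, hx, ht⟩
  | case2 L M P ih =>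
    rw [toStrands] at hm
    rcases ih hm with h | ⟨y, hy, h⟩
    · exact .inl (.inr h)
    · rcases List.mem_append.1 hy with hy | hy
      · exact .inr ⟨y, hy, h⟩
      · obtain rfl := List.mem_singleton.1 hy
        exact .inl (.inl h)
  | case3 L M P ih =>
    rw [toStrands] at hm
    rcases ih hm with h | ⟨y, hy, h⟩
    · exact .inl (.inr h)
    · rcases List.mem_append.1 hy with hy | hy
      · exact .inr ⟨y, hy, h⟩
      · obtain rfl := List.mem_singleton.1 hy
        exact .inl (.inl h)
  | case4 L T P Q R ih₁ ih₂ =>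
    rw [toStrands] at hm
    simp only [msgs_append] at ih₁ ih₂
    rcases hm with hm | hm
    · rcases ih₁ hm with h | ⟨y, hy, h⟩
      · simp only [msgs, Set.mem_union] at h ⊢; tauto
      · rcases List.mem_append.1 hy with hy | hy
        · exact .inr ⟨y, hy, h⟩
        · obtain rfl := List.mem_singleton.1 hy
          exact .inl (.inl (.inl (.inl h)))
    · rcases ih₂ hm with h | ⟨y, hy, h⟩
      · simp only [msgs, Set.mem_union] at h ⊢; tauto
      · rcases List.mem_append.1 hy with hy | hy
        · exact .inr ⟨y, hy, h⟩
        · obtain rfl := List.mem_singleton.1 hy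
          rw [SMsg.msgs, Cond.msgs_neg] at h
          exact .inl (.inl (.inl (.inl h)))
  | case5 L P Q R ih₁ ih₂ =>
    rw [toStrands] at hm
    simp only [msgs_append] at ih₁ ih₂
    rcases hm with hm | hm
    · rcases ih₁ hm with h | ⟨y, hy, h⟩
      · simp only [msgs, Set.mem_union] at h ⊢; tauto
      · rcases List.mem_append.1 hy with hy | hy
        · exact .inr ⟨y, hy, h⟩
        · obtain rfl := List.mem_singleton.1 hy
          exact h.elim
    · rcases ih₂ hm with h | ⟨y, hy, h⟩
      · simp only [msgs, Set.mem_union] at h ⊢; tauto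
      · rcases List.mem_append.1 hy with hy | hy
        · exact .inr ⟨y, hy, h⟩
        · obtain rfl := List.mem_singleton.1 hy
          exact h.elim

theorem Protocol.hasSort_of_mem_strandSpec {ro : Role} {m : List (SMsg (Term Sg Role))}
    (hm : (ro, m) ∈ P.strandSpec) {x : SMsg (Term Sg Role)} (hx : x ∈ m) {t : Term Sg Role}
    (ht : t ∈ x.msgs) : HasSort t Sg.msg := by
  rcases Proc.mem_msgs_of_mem_toStrands hm hx ht with h | ⟨y, hy, -⟩
  · exact P.msg_sorted ro t h
  · simp at hy

/-! ## Instances of states with additional facts -/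

/-- The message substitution `θ`, extended by the identity on the other variables except that the
variable `i` for sets of facts is mapped to itself together with `F`. -/
noncomputable def SSubst.addFacts (θ : Var Sg → Term Sg Role) (i : ℕ)
    (F : Multiset (Fact (Term Sg Role))) : SSubst Sg Role :=
  ⟨θ, fun n => [.inr n], fun n => {.inr n}, fun n => .inr n ::ₘ if n = i then F.map .inl else 0⟩

section addFacts

variable {θ : Var Sg → Term Sg Role} {i : ℕ} {F : Multiset (Fact (Term Sg Role))}

theorem SSubst.addFacts_sorted (hθ : IsSubst θ) (hF : ∀ f ∈ F, HasSort f.msg Sg.msg) :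
    (addFacts θ i F).Sorted := by
  refine ⟨hθ, fun n m h => ?_, fun n m h => ?_, fun n m h => ?_⟩
  · simp [addFacts] at h
  · simp [addFacts] at h
  · by_cases hn : n = i
    · simp only [addFacts, hn, if_true, Multiset.mem_cons, reduceCtorEq, false_or,
        Multiset.mem_map, Sum.inl.injEq, exists_eq_right] at h
      exact hF m h
    · simp [addFacts, hn] at h

/-- The factor `c` counts the occurrences of the variable `i` in `A`: a union may contain the same
variable several times, and each occurrence contributes a copy of `F`. -/
theorem SSubst.exists_lefts_onIk_addFacts (A : Multiset (Fact (Term Sg Role) ⊕ ℕ)) :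
    ∃ c : ℕ, lefts (mapIk (cls E) ((addFacts θ i F).onIk A)) =
      (lefts A).map (Fact.map (cview E θ)) + c • F.map (Fact.map (cls E)) := by
  simp only [mapIk, lefts_map]
  induction A using Multiset.induction with
  | empty => exact ⟨0, by simp⟩
  | cons e A ih =>
    obtain ⟨c, hc⟩ := ih
    cases e with
    | inl f =>
      refine ⟨c, ?_⟩
      rw [onIk_cons_inl, lefts_cons_inl, lefts_cons_inl, Multiset.map_cons, Multiset.map_cons, hc,
        Fact.map_map, Multiset.cons_add]
      rfl
    | inr n =>
      by_cases hn : n = i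
      · refine ⟨c + 1, ?_⟩
        rw [onIk_cons_inr, lefts_cons_inr, lefts_add, Multiset.map_add, hc]
        simp only [addFacts, hn, if_true, lefts_cons_inr, lefts_map_inl]
        rw [add_nsmul, one_nsmul]
        abel
      · refine ⟨c, ?_⟩
        rw [onIk_cons_inr, lefts_cons_inr, lefts_add, Multiset.map_add, hc]
        simp [addFacts, hn]

end addFacts

/-! ## Moving the bar -/

/-- Moving the bar leaves the concatenation of past and future unchanged, and only the concatenation
is compared with the specification. -/
theorem isSpecStrand_beforePat {σ : SSubst Sg Role} {u : SMsg (Term Sg Role)}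
    {F : Multiset (Fact (Term Sg Role))}
    (h : ∀ s, .inl s ∈ σ.onStrands (afterPat u F).strands → IsSpecStrand P (s.map (cls P.E)))
    (s : Strand (Term Sg Role)) (hs : .inl s ∈ σ.onStrands (beforePat u F).strands) :
    IsSpecStrand P (s.map (cls P.E)) := by
  simp only [afterPat, beforePat, Multiset.insert_eq_cons, SSubst.onStrands_cons_inr,
    SSubst.onStrands_singleton_inl, Multiset.mem_add, Multiset.mem_singleton, Sum.inl.injEq,
    SSubst.onStrand, SSubst.onList_cons_inr, SSubst.onList_cons_inl, SSubst.onList_nil,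
    List.append_nil] at h hs
  rcases hs with hs | rfl
  · exact h s (.inl hs)
  · obtain ⟨p, f, heq, ro, m, ρ, hm, hρ, hi⟩ := isSpecStrand_map_iff.1 (h _ (.inr rfl))
    simp only [Strand.mk.injEq] at heq
    -- The whole past is free of list variables, hence so is the value of the rule's variable for
    -- the part before `u`.
    obtain ⟨p₁, p₂, rfl, h₁, h₂⟩ := List.append_eq_map_iff.1 heq.1
    rw [heq.2, ← h₁]
    obtain ⟨a, rfl⟩ : ∃ a, p₂ = [a] := by
      rcases p₂ with _ | ⟨a, _ | _⟩
      · simp at h₂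
      · exact ⟨a, rfl⟩
      · simp at h₂
    simp only [List.map_cons, List.map_nil, List.cons.injEq, Sum.inl.injEq, and_true] at h₂
    refine isSpecStrand_map_iff.2 ⟨p₁, a :: f, by simp [← h₂], ro, m, ρ, hm, hρ, ?_⟩
    rw [hi]
    simp

theorem sorted_afterPat {u : SMsg (Term Sg Role)} {F : Multiset (Fact (Term Sg Role))}
    (hu : ∀ t ∈ u.msgs, HasSort t Sg.msg) (hF : ∀ f ∈ F, HasSort f.msg Sg.msg) :
    (afterPat u F).Sorted := by
  refine ⟨fun s hs => ?_, fun f hf => ?_⟩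
  · simp only [afterPat, Multiset.insert_eq_cons, Multiset.mem_cons, reduceCtorEq,
      Multiset.mem_singleton, Sum.inl.injEq, false_or] at hs
    subst hs
    refine ⟨fun m hm => ?_, fun m hm => by simp at hm⟩
    simp only [List.mem_cons, reduceCtorEq, Sum.inl.injEq, List.not_mem_nil, or_false,
      false_or] at hm
    exact hm ▸ hu
  · exact hF f (by simpa [afterPat] using hf)

theorem sorted_beforePat {u : SMsg (Term Sg Role)} {F : Multiset (Fact (Term Sg Role))}
    (hu : ∀ t ∈ u.msgs, HasSort t Sg.msg) (hF : ∀ f ∈ F, HasSort f.msg Sg.msg) :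
    (beforePat u F).Sorted := by
  refine ⟨fun s hs => ?_, fun f hf => ?_⟩
  · simp only [beforePat, Multiset.insert_eq_cons, Multiset.mem_cons, reduceCtorEq,
      Multiset.mem_singleton, Sum.inl.injEq, false_or] at hs
    subst hs
    refine ⟨fun m hm => by simp at hm, fun m hm => ?_⟩
    simp only [List.mem_cons, reduceCtorEq, Sum.inl.injEq, List.not_mem_nil, or_false] at hm
    exact hm ▸ hu
  · exact hF f (by simpa [beforePat] using hf)

variable {csu : SState (Term Sg Role) → SState (Term Sg Role) → Set (SVar Sg) →
  Set (SSubst Sg Role)}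

/-- Facts demanded by the rule need not occur in the state: they are placed in the value of one of
its variables for further facts. This accounts for the extra copies of the rule's facts in the
bound. -/
theorem exists_narrowStep_bar (hcsu : IsUnificationProcedure P.E csu) {C : CState Sg Role}
    (hC : IsSymbolicState P C) {θ : Var Sg → Term Sg Role} (hθ : IsSubst θ)
    (hsat : SatBy P.E C.cstr θ) {p f : List (SMsg (Term Sg Role))} {u : SMsg (Term Sg Role)}
    {A : Multiset (Strand (Term Sg Role) ⊕ ℕ)}
    (hA : C.st.strands = .inl ⟨(p ++ [u]).map .inl, f.map .inl⟩ ::ₘ A)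
    {u₀ : SMsg (Term Sg Role)} {F : Multiset (Fact (Term Sg Role))}
    {d : Option (Term Sg Role × Term Sg Role)}
    (hR : BWRule P ⟨afterPat u₀ F, beforePat u₀ F, d⟩)
    (hu₀ : ∀ t ∈ u₀.msgs, HasSort t Sg.msg) (hF : ∀ f ∈ F, HasSort f.msg Sg.msg)
    (hd : ∀ p, d = some p → HasSort p.1 Sg.msg ∧ HasSort p.2 Sg.msg)
    {κ : Var Sg → Term Sg Role} (hκ : IsSubst κ)
    (hu : u₀.map (cview P.E κ) = u.map (cview P.E θ))
    (hdκ : SatBy P.E (d.elim 0 fun p => {p}) κ) :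
    ∃ (C' : CState Sg Role) (σ : SSubst Sg Role) (θ' : Var Sg → Term Sg Role) (c : ℕ),
      NarrowStep P csu C σ C' ∧ IsSymbolicState P C' ∧ IsSubst θ' ∧
      strandView P.E θ' C'.st ≤
        Strand.map (cview P.E θ) ⟨p.map .inl, (u :: f).map .inl⟩ ::ₘ
          (lefts A).map (Strand.map (cview P.E θ)) ∧
      factView P.E θ' C'.st ≤ factView P.E θ C.st + c • F.map (Fact.map (cview P.E κ)) ∧
      C'.cstr.map (pairView P.E θ') =
        C.cstr.map (pairView P.E θ) +
          (d.elim 0 fun p => {p} : Multiset (Term Sg Role × Term Sg Role)).map (pairView P.E κ) := by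
  obtain ⟨i, hi⟩ := hC.has_IK
  obtain ⟨B, hB⟩ := Multiset.exists_cons_of_mem hi
  set F' := F.map (Fact.map (Term.subst κ)) with hF'
  have hF's : ∀ f ∈ F', HasSort f.msg Sg.msg := fun f hf => by
    obtain ⟨g, hg, rfl⟩ := Multiset.mem_map.1 hf
    rw [Fact.msg_map]
    exact (hF g hg).subst hκ
  set b := SSubst.addFacts θ i F'
  have hb : b.Sorted := SSubst.addFacts_sorted hθ hF's
  set l₁ := (p.map (SMsg.map (Term.subst θ))).map (Sum.inl (β := ℕ)) with hl₁
  set l₂ := (f.map (SMsg.map (Term.subst θ))).map (Sum.inl (β := ℕ)) with hl₂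
  have hl₁' : mapList (cls P.E) l₁ = mapList (cview P.E θ) (p.map .inl) := by
    rw [hl₁, ← mapList_inl, mapList_mapList]
    rfl
  have hl₂' : mapList (cls P.E) l₂ = mapList (cview P.E θ) (f.map .inl) := by
    rw [hl₂, ← mapList_inl, mapList_mapList]
    rfl
  -- The rule's `L` (index 0) and `L'` (index 1) receive the strand around `u`, `SS` receives the
  -- other strands, and `IK` receives all facts except the copy of `F'` taken from the chosen
  -- occurrence of `i`.
  let k : SSubst Sg Role := ⟨κ, fun n => if n = 0 then l₁ else l₂, fun _ => b.onStrands A,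
    fun _ => .inr i ::ₘ b.onIk B⟩
  have hsorted := hC.sorted.1 ⟨(p ++ [u]).map .inl, f.map .inl⟩ (by simp [hA])
  have hk : k.Sorted := by
    have hp : SortedList (p.map (Sum.inl (β := ℕ))) := fun m hm =>
      hsorted.1 m (by simpa using Or.inl (by simpa using hm))
    refine ⟨hκ, fun n => ?_, fun n => hb.onStrands fun s hs => hC.sorted.1 s (by simp [hA, hs]),
      fun n f hf => ?_⟩
    · have h₁ := hb.onList hp
      have h₂ := hb.onList hsorted.2
      rw [SSubst.onList_inl] at h₁ h₂
      by_cases hn : n = 0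
      · simp only [k, hn, if_true]
        exact h₁
      · simp only [k, hn, if_false]
        exact h₂
    · simp only [k, Multiset.mem_cons, reduceCtorEq, false_or] at hf
      exact hb.onIk (A := B) (fun g hg => hC.sorted.2 g (by simp [hB, hg])) f hf
  have hRs : Rule.Sorted ⟨afterPat u₀ F, beforePat u₀ F, d⟩ :=
    ⟨sorted_afterPat hu₀ hF, sorted_beforePat hu₀ hF, fun p hp => hd p (Rule.mem_diseqs.1 hp)⟩
  have huκ : (u₀.map (Term.subst κ)).map (cls P.E) = u.map (cview P.E θ) := by
    rw [SMsg.map_map]; exact hu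
  have hunif : (b.onState C.st).map (cls P.E) = (k.onState (afterPat u₀ F)).map (cls P.E) := by
    simp only [SState.map, SSubst.onState, SState.mk.injEq]
    constructor
    · simp only [hA, afterPat, Multiset.insert_eq_cons, SSubst.onStrands_cons_inr,
        SSubst.onStrands_singleton_inl, SSubst.onStrands_cons_inl, mapStrands, Multiset.map_cons,
        Multiset.map_add, Multiset.map_singleton, Sum.map_inl]
      rw [map_onStrand_of_proper b rfl, add_comm, Multiset.singleton_add]
      congr 2
      simp only [Strand.map, SSubst.onStrand, SSubst.onList_cons_inr, SSubst.onList_cons_inl,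
        SSubst.onList_nil, List.append_nil, List.map_append, mapList_append, Strand.mk.injEq]
      refine ⟨?_, hl₂'.symm⟩
      change mapList (cview P.E θ) (p.map .inl) ++ [Sum.inl (u.map (cview P.E θ))] =
        mapList (cls P.E) l₁ ++ [Sum.inl ((u₀.map (Term.subst κ)).map (cls P.E))]
      rw [hl₁', huκ]
    · simp only [hB, afterPat, SSubst.onIk_add, SSubst.onIk_cons_inr, SSubst.onIk_map_inl,
        SSubst.onIk_singleton_inr]
      congr 1
      change (.inr i ::ₘ (if i = i then F'.map .inl else 0)) + b.onIk B =
        F'.map .inl + .inr i ::ₘ b.onIk B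
      rw [if_pos rfl, Multiset.cons_add, Multiset.add_cons]
  obtain ⟨C', σ, θ', hstep, hC', hθ', hs, hf, hc⟩ := exists_narrowStep_symbolic hcsu hC hR hRs
    (fun σ _ h => isSpecStrand_beforePat h)
    (fun σ n hn => by simpa [afterPat, beforePat] using hn)
    (fun σ n hn => by simpa [afterPat, beforePat] using hn)
    hb hk (fun n => rfl) (fun n => Multiset.mem_cons_self _ _) hunif hsat hdκ
  obtain ⟨c, hcF⟩ := SSubst.exists_lefts_onIk_addFacts (E := P.E) (θ := θ) (i := i) (F := F')
    C.st.ik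
  refine ⟨C', σ, θ', c, hstep, hC', hθ', hs.trans_eq ?_, hf.trans_eq ?_, hc⟩
  · simp only [beforePat, Multiset.insert_eq_cons, SSubst.onStrands_cons_inr,
      SSubst.onStrands_singleton_inl, mapStrands, Multiset.map_add, lefts_add,
      Multiset.map_singleton, Sum.map_inl, lefts_singleton_inl]
    have h := map_strands_eq (E := P.E) b (fun n => rfl) (A := A) fun s hs =>
      (hC.isSpecStrand (s := s) (by simp [hA, hs])).proper
    rw [mapStrands] at h
    change lefts (Multiset.map _ (b.onStrands A)) + _ = _
    rw [h, add_comm, Multiset.singleton_add]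
    congr 1
    simp only [Strand.map, SSubst.onStrand, SSubst.onList_cons_inr, SSubst.onList_cons_inl,
      SSubst.onList_nil, List.append_nil, Strand.mk.injEq]
    refine ⟨hl₁', ?_⟩
    change Sum.inl ((u₀.map (Term.subst κ)).map (cls P.E)) :: mapList (cls P.E) l₂ =
      Sum.inl (u.map (cview P.E θ)) :: mapList (cview P.E θ) (f.map .inl)
    rw [hl₂', huκ]
  -- A bar move with the same `F` in both patterns does not change the facts, so their instance is
  -- already known from the state side of the unification equation.
  · have h : mapIk (cls P.E) (k.onIk (afterPat u₀ F).ik) = mapIk (cls P.E) (b.onIk C.st.ik) :=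
      (congrArg SState.ik hunif).symm
    change lefts (mapIk (cls P.E) (k.onIk (afterPat u₀ F).ik)) = _
    rw [h, hcF, hF', Multiset.map_map, factView]
    congr 2
    exact Multiset.map_congr rfl fun f _ => Fact.map_map _ _ f

/-! ## Introducing a new strand -/

/-- The rule's set variable takes all strands of the state and its fact variable takes the facts
other than `m`. The added strand is an instance of the specification by `κ`, independent of `θ`. -/
theorem exists_narrowStep_new (hcsu : IsUnificationProcedure P.E csu) {C : CState Sg Role}
    (hC : IsSymbolicState P C) {θ : Var Sg → Term Sg Role} (hθ : IsSubst θ)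
    (hsat : SatBy P.E C.cstr θ) {m : Term Sg Role} {B : Multiset (Fact (Term Sg Role) ⊕ ℕ)}
    (hB : C.st.ik = .inl (.known m) ::ₘ B)
    {ro : Role} {l₁ l₂ : List (SMsg (Term Sg Role))} {M : Term Sg Role}
    (hM : (ro, l₁ ++ .send M :: l₂) ∈ P.strandSpec)
    {κ : Var Sg → Term Sg Role} (hκ : IsSubst κ) (hm : cview P.E κ M = cview P.E θ m) :
    ∃ (C' : CState Sg Role) (σ : SSubst Sg Role) (θ' : Var Sg → Term Sg Role),
      NarrowStep P csu C σ C' ∧ IsSymbolicState P C' ∧ IsSubst θ' ∧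
      strandView P.E θ' C'.st ≤
        Strand.map (cview P.E κ) ⟨l₁.map .inl, (.send M :: l₂).map .inl⟩ ::ₘ
          strandView P.E θ C.st ∧
      factView P.E θ' C'.st ≤
        .unknown (cview P.E θ m) ::ₘ (lefts B).map (Fact.map (cview P.E θ)) ∧
      C'.cstr.map (pairView P.E θ') = C.cstr.map (pairView P.E θ) := by
  -- No facts are added here, so the index 0 is immaterial.
  set b := SSubst.addFacts θ 0 (0 : Multiset (Fact (Term Sg Role)))
  have hb : b.Sorted := SSubst.addFacts_sorted hθ (by simp)
  let k : SSubst Sg Role := ⟨κ, fun n => [.inr n], fun _ => b.onStrands C.st.strands,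
    fun _ => b.onIk B⟩
  have hk : k.Sorted := by
    refine ⟨hκ, fun n m hm => by simp [k] at hm, fun n => hb.onStrands hC.sorted.1,
      fun n => hb.onIk fun g hg => hC.sorted.2 g (by simp [hB, hg])⟩
  have hsort : ∀ x ∈ l₁ ++ .send M :: l₂, ∀ t ∈ x.msgs, HasSort t Sg.msg :=
    fun x hx t ht => P.hasSort_of_mem_strandSpec hM hx ht
  have hMs : HasSort M Sg.msg := hsort (.send M) (by simp) M rfl
  have hR := BWRule.newStrand (P := P) ro l₁ l₂ M hM
  have hRs : Rule.Sorted ⟨⟨{.inr 0}, {.inl (.known M), .inr 0}⟩,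
      ⟨{.inr 0, .inl ⟨l₁.map .inl, .inl (.send M) :: l₂.map .inl⟩},
        {.inl (.unknown M), .inr 0}⟩, none⟩ := by
    refine ⟨⟨fun s hs => by simp at hs, fun f hf => ?_⟩, ⟨fun s hs => ?_, fun f hf => ?_⟩,
      fun p hp => by simp [Rule.diseqs] at hp⟩
    · obtain rfl : f = .known M := by simpa using hf
      exact hMs
    · obtain rfl : s = ⟨l₁.map .inl, .inl (.send M) :: l₂.map .inl⟩ := by simpa using hs
      refine ⟨fun x hx => hsort x ?_, fun x hx => hsort x ?_⟩
      · simpa using Or.inl (by simpa using hx)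
      · simp only [List.mem_cons, Sum.inl.injEq, List.mem_map, exists_eq_right] at hx
        simp [hx]
    · obtain rfl : f = .unknown M := by simpa using hf
      exact hMs
  have hunif : (b.onState C.st).map (cls P.E) =
      (k.onState ⟨{.inr 0}, {.inl (.known M), .inr 0}⟩).map (cls P.E) := by
    simp only [SState.map, SSubst.onState, SState.mk.injEq]
    constructor
    · rw [SSubst.onStrands_singleton_inr]
    · rw [hB, Multiset.insert_eq_cons, SSubst.onIk_cons_inl, SSubst.onIk_cons_inl,
        SSubst.onIk_singleton_inr, mapIk, mapIk, Multiset.map_cons, Multiset.map_cons]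
      congr 1
      exact congrArg (Sum.inl ∘ Fact.known) hm.symm
  obtain ⟨C', σ, θ', hstep, hC', hθ', hs, hf, hc⟩ := exists_narrowStep_symbolic hcsu hC hR hRs
    (fun σ hσ h s hs => by
      simp only [Multiset.insert_eq_cons, SSubst.onStrands_cons_inr,
        SSubst.onStrands_singleton_inl, SSubst.onStrands_singleton_inr, Multiset.mem_add,
        Multiset.mem_singleton, Sum.inl.injEq] at h hs
      rcases hs with hs | rfl
      · exact h s hs
      · have hp : (⟨l₁.map .inl, .inl (.send M) :: l₂.map .inl⟩ : Strand (Term Sg Role)) =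
            ⟨l₁.map .inl, (.send M :: l₂).map .inl⟩ := rfl
        rw [map_onStrand_of_proper σ hp, hp, Strand.map, mapList_inl, mapList_inl]
        exact ⟨_, _, rfl, ro, _, σ.msg, hM, hσ.1, by rw [inst, List.map_append]; rfl⟩)
    (fun σ n hn => by simpa using hn)
    (fun σ n hn => by simpa using hn)
    hb hk (fun n => rfl) (fun n => Multiset.mem_cons_self _ _) hunif hsat
    (by simp [SatBy, Rule.diseqs])
  refine ⟨C', σ, θ', hstep, hC', hθ', hs.trans_eq ?_, hf.trans_eq ?_, ?_⟩
  · have hp : (⟨l₁.map .inl, .inl (.send M) :: l₂.map .inl⟩ : Strand (Term Sg Role)) =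
        ⟨l₁.map .inl, (.send M :: l₂).map .inl⟩ := rfl
    have h := map_strands_eq (E := P.E) b (fun n => rfl) (A := C.st.strands) fun s hs =>
      (hC.isSpecStrand hs).proper
    simp only [Multiset.insert_eq_cons, SSubst.onStrands_cons_inr,
      SSubst.onStrands_singleton_inl, mapStrands, Multiset.map_add, lefts_add,
      Multiset.map_singleton, Sum.map_inl, lefts_singleton_inl]
    rw [mapStrands] at h
    change lefts (Multiset.map _ (b.onStrands C.st.strands)) + _ = _
    rw [h, add_comm, Multiset.singleton_add, map_onStrand_of_proper k hp]
    rfl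
  · obtain ⟨c, hc⟩ := SSubst.exists_lefts_onIk_addFacts (E := P.E) (θ := θ) (i := 0)
      (F := (0 : Multiset (Fact (Term Sg Role)))) B
    rw [mapIk] at hc
    simp only [Multiset.insert_eq_cons, SSubst.onIk_cons_inl, SSubst.onIk_singleton_inr, mapIk,
      Multiset.map_cons, Sum.map_inl, lefts_cons_inl]
    change _ ::ₘ lefts (Multiset.map _ (b.onIk B)) = _
    rw [hc]
    simp only [Multiset.map_zero, nsmul_zero, add_zero]
    congr 1
    exact congrArg Fact.unknown hm
  · exact hc.trans (by simp [Rule.diseqs]; rfl)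

/-! ## Forward steps as extensions by one strand message -/

/-- Two distinct classes with ground representatives. -/
def IsGroundDiseq (E : Set (Term Sg Role × Term Sg Role)) (q : Cls E × Cls E) : Prop :=
  ∃ a b : Term Sg Role, a.Ground ∧ b.Ground ∧ q = (cls E a, cls E b) ∧ cls E a ≠ cls E b

theorem satBy_of_isGroundDiseq {Ψ : Multiset (Term Sg Role × Term Sg Role)}
    {θ : Var Sg → Term Sg Role} (h : ∀ q ∈ Ψ.map (pairView E θ), IsGroundDiseq E q) :
    SatBy E Ψ θ := satBy_iff.2 fun q hq => by
  obtain ⟨a, b, -, -, rfl, hne⟩ := h q hq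
  exact hne

/-- The strand messages that can be executed with intruder knowledge `IK`. -/
inductive Executable (E : Set (Term Sg Role × Term Sg Role)) (IK : Set (Cls E)) :
    SMsg (Cls E) → Prop
  | send (m : Cls E) : Executable E IK (.send m)
  | recv (m : Cls E) : m ∈ IK → Executable E IK (.recv m)
  | any (n : ℕ) : Executable E IK (.any n)
  | eq (m : Cls E) (n : ℕ) : Executable E IK (.cond (.eq m m) n)
  | ne (m m' : Cls E) (n : ℕ) : IsGroundDiseq E (m, m') → Executable E IK (.cond (.ne m m') n)

/-- `m` is an instance of a message that is sent in a strand of the specification, and `q` is the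
instance of the part of the strand before it. -/
def IsSentAfter (P : Protocol Sg Role) (q : List (SMsg (Cls P.E))) (m : Cls P.E) : Prop :=
  ∃ (ro : Role) (L L' : List (SMsg (Term Sg Role))) (M : Term Sg Role)
    (τ : Var Sg → Term Sg Role), (ro, L ++ .send M :: L') ∈ P.strandSpec ∧ IsSubst τ ∧
      inst P.E τ L = q ∧ m = cls P.E (M.subst τ)

/-- `s'` results from `s` by extending a strand `q` by `x`. -/
structure Extends (P : Protocol Sg Role) (s s' : FWState P) (q : List (SMsg (Cls P.E)))
    (x : SMsg (Cls P.E)) : Prop where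
  strands : ∀ g ∈ s'.strands, g ∈ s.strands ∨ g.msgs = q ++ [x]
  executed : q = [] ∨ ∃ g ∈ s.strands, g.msgs = q
  executable : Executable P.E s.ik x
  ik_subset : s.ik ⊆ s'.ik
  ik : ∀ m ∈ s'.ik, m ∈ s.ik ∨ IsSentAfter P q m

theorem extends_old {ro : Role} {i : ℕ} {L : List (SMsg (Term Sg Role))}
    {y : SMsg (Term Sg Role)} {τ : Var Sg → Term Sg Role} {SS : Multiset (GStrand P)}
    {IK IK' : Set (Cls P.E)}
    (hy : Executable P.E IK (y.map fun t => cls P.E (t.subst τ))) (hsub : IK ⊆ IK')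
    (hik : ∀ m ∈ IK', m ∈ IK ∨ IsSentAfter P (inst P.E τ L) m) :
    Extends P ⟨⟨ro, i, inst P.E τ L⟩ ::ₘ SS, IK⟩ ⟨⟨ro, i, inst P.E τ (L ++ [y])⟩ ::ₘ SS, IK'⟩
      (inst P.E τ L) (y.map fun t => cls P.E (t.subst τ)) where
  strands g hg := by
    rcases Multiset.mem_cons.1 hg with rfl | hg
    · exact .inr (by simp [inst])
    · exact .inl (Multiset.mem_cons_of_mem hg)
  executed := .inr ⟨_, Multiset.mem_cons_self _ _, rfl⟩
  executable := hy
  ik_subset := hsub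
  ik := hik

theorem extends_new {ro : Role} {i : ℕ} {x : SMsg (Cls P.E)} {SS : Multiset (GStrand P)}
    {IK IK' : Set (Cls P.E)} (hx : Executable P.E IK x) (hsub : IK ⊆ IK')
    (hik : ∀ m ∈ IK', m ∈ IK ∨ IsSentAfter P [] m) :
    Extends P ⟨SS, IK⟩ ⟨⟨ro, i, [x]⟩ ::ₘ SS, IK'⟩ [] x where
  strands g hg := by
    rcases Multiset.mem_cons.1 hg with rfl | hg
    · exact .inr rfl
    · exact .inl hg
  executed := .inl rfl
  executable := hx
  ik_subset := hsub
  ik := hik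

/-- Labels, roles and session identifiers play no part in the backwards argument; a step that opens
a strand is the case of an empty `q`. -/
theorem FWStep.exists_extends [DecidableEq Role] {s s' : FWState P}
    {a : Label Role (Cls P.E)} (h : FWStep P s a s') : ∃ q x, Extends P s s' q x := by
  cases h with
  | sendLearn ro i L L' M τ SS IK hL _ hτ _ =>
    refine ⟨_, _, extends_old (.send _) (Set.subset_insert _ _) fun m hm => ?_⟩
    exact (Set.mem_insert_iff.1 hm).symm.imp id fun h => ⟨ro, L, L', M, τ, hL, hτ.1.1, rfl, h⟩
  | send ro i L L' M τ SS IK hL _ hτ =>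
    exact ⟨_, _, extends_old (.send _) subset_rfl fun m => .inl⟩
  | sendLearnNew ro L' M τ SS IK hL hτ _ =>
    refine ⟨_, _, extends_new (.send _) (Set.subset_insert _ _) fun m hm => ?_⟩
    exact (Set.mem_insert_iff.1 hm).symm.imp id fun h => ⟨ro, [], L', M, τ, hL, hτ.1.1, rfl, h⟩
  | sendNew ro L' M τ SS IK hL hτ =>
    exact ⟨_, _, extends_new (.send _) subset_rfl fun m => .inl⟩
  | recv ro i L L' M τ SS IK hL _ hτ hM =>
    exact ⟨_, _, extends_old (.recv _ hM) subset_rfl fun m => .inl⟩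
  | recvNew ro L' M τ SS IK hL hτ hM =>
    exact ⟨_, _, extends_new (.recv _ hM) subset_rfl fun m => .inl⟩
  | cond ro i L L' T n τ SS IK hL _ hτ hT =>
    refine ⟨_, _, extends_old ?_ subset_rfl fun m => .inl⟩
    cases T with
    | eq a b =>
      -- The backwards rule for equalities has one variable on both sides, so the two sides must be
      -- presented as the same class.
      have hab : cls P.E (a.subst τ) = cls P.E (b.subst τ) := hT
      simp only [SMsg.map, Cond.map, hab]
      exact .eq _ _
    | ne a b =>
      exact .ne _ _ _ ⟨_, _, Term.ground_subst hτ.1.2 a, Term.ground_subst hτ.1.2 b, rfl, hT⟩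
  | any ro i L L' n τ SS IK hL _ hτ =>
    exact ⟨_, _, extends_old (.any n) subset_rfl fun m => .inl⟩
  | anyNew ro L' n SS IK hL =>
    exact ⟨_, _, extends_new (.any n) subset_rfl fun m => .inl⟩

/-! ## The bar rule for an executable strand message -/

/-- The substitution for the message variables of the rules. -/
noncomputable def ruleSubst (a b : Term Sg Role) (x : Var Sg) : Term Sg Role :=
  open Classical in if x = ⟨Sg.msg, 0⟩ then a else if x = ⟨Sg.msg, 1⟩ then b else .var x

theorem isSubst_ruleSubst {a b : Term Sg Role} (ha : HasSort a Sg.msg) (hb : HasSort b Sg.msg) :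
    IsSubst (ruleSubst a b) := by
  intro x
  unfold ruleSubst
  split_ifs with h h'
  · rw [h]; exact ha
  · rw [h']; exact hb
  · exact .var x

theorem cview_ruleSubst_zero (a b : Term Sg Role) :
    cview E (ruleSubst a b) (ruleVar 0) = cls E a := by
  simp [cview, ruleVar, Term.subst, ruleSubst]

theorem cview_ruleSubst_one (a b : Term Sg Role) :
    cview E (ruleSubst a b) (ruleVar 1) = cls E b := by
  simp [cview, ruleVar, Term.subst, ruleSubst]

theorem hasSort_ruleVar (k : ℕ) : HasSort (ruleVar k : Term Sg Role) Sg.msg := .var _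

/-- The shape of `u` selects the rule, and `κ` sends the rule variables to the `θ`-instances of the
messages in `u`. A send always uses the rule without learning; only a receive requires a fact, and
only a disequality extends the constraint. -/
theorem exists_bar_rule {θ : Var Sg → Term Sg Role} (hθ : IsSubst θ) {u : SMsg (Term Sg Role)}
    (hu : ∀ t ∈ u.msgs, HasSort t Sg.msg) {IK : Set (Cls P.E)}
    (hx : Executable P.E IK (u.map (cview P.E θ))) :
    ∃ (u₀ : SMsg (Term Sg Role)) (F : Multiset (Fact (Term Sg Role)))
      (d : Option (Term Sg Role × Term Sg Role)) (κ : Var Sg → Term Sg Role),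
      BWRule P ⟨afterPat u₀ F, beforePat u₀ F, d⟩ ∧ (∀ t ∈ u₀.msgs, HasSort t Sg.msg) ∧
      (∀ f ∈ F, HasSort f.msg Sg.msg) ∧
      (∀ p, d = some p → HasSort p.1 Sg.msg ∧ HasSort p.2 Sg.msg) ∧ IsSubst κ ∧
      u₀.map (cview P.E κ) = u.map (cview P.E θ) ∧
      (∀ f ∈ F, ∃ m ∈ IK, f.map (cview P.E κ) = .known m) ∧
      ∀ p, d = some p → IsGroundDiseq P.E (pairView P.E κ p) := by
  rcases u with a | a | n | ⟨⟨a, b⟩ | ⟨a, b⟩, n⟩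
  · have ha := (hu a rfl).subst hθ
    refine ⟨_, 0, none, ruleSubst (a.subst θ) (a.subst θ), .send, ?_, by simp, by simp,
      isSubst_ruleSubst ha ha, ?_, by simp, by simp⟩
    · rintro t rfl; exact hasSort_ruleVar 0
    · rw [SMsg.map, cview_ruleSubst_zero]; rfl
  · have ha := (hu a rfl).subst hθ
    refine ⟨_, _, none, ruleSubst (a.subst θ) (a.subst θ), .recv, ?_, ?_, by simp,
      isSubst_ruleSubst ha ha, ?_, ?_, by simp⟩
    · rintro t rfl; exact hasSort_ruleVar 0
    · rintro f hf
      rw [Multiset.mem_singleton.1 hf]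
      exact hasSort_ruleVar 0
    · rw [SMsg.map, cview_ruleSubst_zero]; rfl
    · rintro f hf
      rw [Multiset.mem_singleton.1 hf, Fact.map, cview_ruleSubst_zero]
      cases hx with
      | recv m hm => exact ⟨_, hm, rfl⟩
  · exact ⟨_, 0, none, .var, .any n, by simp [SMsg.msgs], by simp, by simp, isSubst_var, rfl,
      by simp, by simp⟩
  · have ha := (hu a (.inl rfl)).subst hθ
    refine ⟨_, 0, none, ruleSubst (a.subst θ) (a.subst θ), .condEq n, ?_, by simp, by simp,
      isSubst_ruleSubst ha ha, ?_, by simp, by simp⟩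
    · rintro t (rfl | rfl) <;> exact hasSort_ruleVar 0
    · rw [SMsg.map, Cond.map, cview_ruleSubst_zero]
      rw [SMsg.map, Cond.map] at hx ⊢
      -- With both classes made variables, executability identifies them, so the single value of `κ`
      -- serves both sides.
      generalize hy : cview P.E θ b = y at hx ⊢
      generalize hz : cview P.E θ a = z at hx ⊢
      cases hx
      rw [← hz]
      rfl
  · have ha := (hu a (.inl rfl)).subst hθ
    have hb := (hu b (.inr rfl)).subst hθ
    refine ⟨_, 0, some (ruleVar 0, ruleVar 1), ruleSubst (a.subst θ) (b.subst θ), .condNe n, ?_,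
      by simp, ?_, isSubst_ruleSubst ha hb, ?_, by simp, ?_⟩
    · rintro t (rfl | rfl)
      exacts [hasSort_ruleVar 0, hasSort_ruleVar 1]
    · rintro p ⟨⟩
      exact ⟨hasSort_ruleVar 0, hasSort_ruleVar 1⟩
    · rw [SMsg.map, Cond.map, cview_ruleSubst_zero, cview_ruleSubst_one]
      rfl
    · rintro p ⟨⟩
      rw [pairView, cview_ruleSubst_zero, cview_ruleSubst_one]
      cases hx with
      | ne _ _ _ h => exact h

/-! ## Completeness -/

/-- The first alternative is needed because ground states leave strands with nothing executed
implicit. -/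
def StrandOK (s : FWState P) (st : Strand (Cls P.E)) : Prop :=
  st.past = [] ∨ ∃ g ∈ s.strands, st.past = g.msgs.map .inl

def FactOK (s : FWState P) : Fact (Cls P.E) → Prop
  | .known m => m ∈ s.ik
  | .unknown m => m ∉ s.ik

/-- The symbolic state `C` has the instance `s`, by a substitution that need not be ground. -/
structure Represents (C : CState Sg Role) (θ : Var Sg → Term Sg Role) (s : FWState P) :
    Prop where
  symbolic : IsSymbolicState P C
  subst : IsSubst θ
  strand : ∀ st ∈ strandView P.E θ C.st, StrandOK s st
  fact : ∀ f ∈ factView P.E θ C.st, FactOK s f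
  cstr : ∀ q ∈ C.cstr.map (pairView P.E θ), IsGroundDiseq P.E q

/-- Restates the bar move on instances modulo `E`: exactly the chosen strand is exchanged, and every
added fact is true in the earlier state because `x` was executable there. -/
theorem exists_narrowStep_of_executable (hcsu : IsUnificationProcedure P.E csu)
    {C : CState Sg Role} (hC : IsSymbolicState P C) {θ : Var Sg → Term Sg Role} (hθ : IsSubst θ)
    (hcstr : ∀ q ∈ C.cstr.map (pairView P.E θ), IsGroundDiseq P.E q)
    {st : Strand (Cls P.E)} (hst : st ∈ strandView P.E θ C.st) {q : List (SMsg (Cls P.E))}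
    {x : SMsg (Cls P.E)} (hq : st.past = (q ++ [x]).map .inl) {IK : Set (Cls P.E)}
    (hx : Executable P.E IK x) :
    ∃ (C' : CState Sg Role) (σ : SSubst Sg Role) (θ' : Var Sg → Term Sg Role)
      (A : Multiset (Strand (Cls P.E))) (st' : Strand (Cls P.E)) (c : ℕ)
      (F : Multiset (Fact (Cls P.E))),
      NarrowStep P csu C σ C' ∧ IsSymbolicState P C' ∧ IsSubst θ' ∧
      strandView P.E θ C.st = st ::ₘ A ∧ strandView P.E θ' C'.st ≤ st' ::ₘ A ∧
      st'.past = q.map .inl ∧ factView P.E θ' C'.st ≤ factView P.E θ C.st + c • F ∧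
      (∀ f ∈ F, ∃ m ∈ IK, f = .known m) ∧
      ∀ q ∈ C'.cstr.map (pairView P.E θ'), IsGroundDiseq P.E q := by
  obtain ⟨s₀, hs₀, rfl⟩ := Multiset.mem_map.1 hst
  rw [mem_lefts] at hs₀
  obtain ⟨p', f, rfl⟩ := (hC.isSpecStrand hs₀).proper
  rw [Strand.map, mapList_inl] at hq
  obtain ⟨p, p₂, rfl, rfl, hu⟩ :=
    List.map_eq_append_iff.1 (List.map_injective_iff.2 Sum.inl_injective hq)
  obtain ⟨u, rfl, rfl⟩ := List.map_eq_singleton_iff.1 hu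
  obtain ⟨A, hA⟩ := Multiset.exists_cons_of_mem hs₀
  have hus : ∀ t ∈ u.msgs, HasSort t Sg.msg := (hC.sorted.1 _ hs₀).1 u (by simp)
  obtain ⟨u₀, F, d, κ, hR, hu₀, hF, hd, hκ, heq, hFm, hdκ⟩ := exists_bar_rule (P := P) hθ hus hx
  have hdκ' : ∀ q ∈ (d.elim 0 fun p => {p} :
      Multiset (Term Sg Role × Term Sg Role)).map (pairView P.E κ), IsGroundDiseq P.E q := by
    intro q hq
    obtain ⟨p, hp, rfl⟩ := Multiset.mem_map.1 hq
    refine hdκ p ?_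
    cases d with
    | none => simp at hp
    | some p' => rw [Multiset.mem_singleton.1 hp]
  obtain ⟨C', σ, θ', c, hstep, hC', hθ', hs, hf, hc⟩ := exists_narrowStep_bar hcsu hC hθ
    (satBy_of_isGroundDiseq hcstr) hA hR hu₀ hF hd hκ heq (satBy_of_isGroundDiseq hdκ')
  refine ⟨C', σ, θ', _, _, c, _, hstep, hC', hθ', ?_, hs, ?_, hf, ?_, ?_⟩
  · rw [strandView, hA, lefts_cons_inl, Multiset.map_cons]
  · rw [Strand.map, mapList_inl]
  · intro g hg
    obtain ⟨g', hg', rfl⟩ := Multiset.mem_map.1 hg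
    exact hFm g' hg'
  · intro q hq
    rw [hc] at hq
    rcases Multiset.mem_add.1 hq with h | h
    · exact hcstr q h
    · exact hdκ' q h

theorem exists_narrowStep_of_isSentAfter (hcsu : IsUnificationProcedure P.E csu)
    {C : CState Sg Role} (hC : IsSymbolicState P C) {θ : Var Sg → Term Sg Role} (hθ : IsSubst θ)
    (hcstr : ∀ q ∈ C.cstr.map (pairView P.E θ), IsGroundDiseq P.E q)
    {m : Cls P.E} (hm : .known m ∈ factView P.E θ C.st) {q : List (SMsg (Cls P.E))}
    (hq : IsSentAfter P q m) :
    ∃ (C' : CState Sg Role) (σ : SSubst Sg Role) (θ' : Var Sg → Term Sg Role)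
      (A : Multiset (Fact (Cls P.E))) (st' : Strand (Cls P.E)),
      NarrowStep P csu C σ C' ∧ IsSymbolicState P C' ∧ IsSubst θ' ∧
      strandView P.E θ' C'.st ≤ st' ::ₘ strandView P.E θ C.st ∧ st'.past = q.map .inl ∧
      factView P.E θ C.st = .known m ::ₘ A ∧ factView P.E θ' C'.st ≤ .unknown m ::ₘ A ∧
      ∀ q ∈ C'.cstr.map (pairView P.E θ'), IsGroundDiseq P.E q := by
  obtain ⟨f, hf, hfm⟩ := Multiset.mem_map.1 hm
  rw [mem_lefts] at hf
  cases f with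
  | unknown t => simp [Fact.map] at hfm
  | known t =>
    obtain rfl : cview P.E θ t = m := by simpa [Fact.map] using hfm
    obtain ⟨B, hB⟩ := Multiset.exists_cons_of_mem hf
    obtain ⟨ro, L, L', M, τ, hL, hτ, rfl, hM⟩ := hq
    obtain ⟨C', σ, θ', hstep, hC', hθ', hs, hf, hc⟩ := exists_narrowStep_new hcsu hC hθ
      (satBy_of_isGroundDiseq hcstr) hB hL hτ hM.symm
    refine ⟨C', σ, θ', _, _, hstep, hC', hθ', hs, ?_, ?_, hf, hc ▸ hcstr⟩
    · rw [Strand.map, mapList_inl]; rfl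
    · rw [factView, hB, lefts_cons_inl, Multiset.map_cons]; rfl

open Classical in
-- Induction on a bound `n` for the number of strands and facts that fail in `s`. Repairing a strand
-- adds only facts true in `s`; repairing a fact adds only a strand with past `q` and a negative
-- fact true in `s`. So each narrowing step lowers the count.
theorem Extends.exists_narrows (hcsu : IsUnificationProcedure P.E csu) {s s' : FWState P}
    {q : List (SMsg (Cls P.E))} {x : SMsg (Cls P.E)} (hx : Extends P s s' q x) (n : ℕ) :
    ∀ (C : CState Sg Role) (θ : Var Sg → Term Sg Role), IsSymbolicState P C → IsSubst θ →
    (∀ st ∈ strandView P.E θ C.st, StrandOK s st ∨ st.past = (q ++ [x]).map .inl) →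
    (∀ f ∈ factView P.E θ C.st, FactOK s f ∨ ∃ m, f = .known m ∧ IsSentAfter P q m) →
    (∀ q ∈ C.cstr.map (pairView P.E θ), IsGroundDiseq P.E q) →
    (strandView P.E θ C.st).countP (fun st => ¬ StrandOK s st) +
      (factView P.E θ C.st).countP (fun f => ¬ FactOK s f) ≤ n →
    ∃ (C' : CState Sg Role) (μ : SSubst Sg Role) (θ' : Var Sg → Term Sg Role),
      Narrows P csu C μ C' ∧ Represents C' θ' s := by
  -- Any strand whose past is `q` is acceptable in `s`: either `q` is empty or it was executed
  -- before the step.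
  have hq : ∀ st : Strand (Cls P.E), st.past = q.map .inl → StrandOK s st := by
    intro st hst
    rcases hx.executed with rfl | ⟨g, hg, rfl⟩
    · exact .inl hst
    · exact .inr ⟨g, hg, hst⟩
  induction n with
  | zero =>
    intro C θ hC hθ _ _ hcstr hn
    obtain ⟨h₁, h₂⟩ := Nat.add_eq_zero_iff.1 (Nat.le_zero.1 hn)
    rw [Multiset.countP_eq_zero] at h₁ h₂
    exact ⟨C, _, θ, .refl C, hC, hθ, fun st hst => not_not.1 (h₁ st hst),
      fun f hf => not_not.1 (h₂ f hf), hcstr⟩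
  | succ n ih =>
    intro C θ hC hθ hstr hfact hcstr hn
    by_cases h₁ : ∃ st ∈ strandView P.E θ C.st, ¬ StrandOK s st
    · obtain ⟨st, hst, hbad⟩ := h₁
      -- A strand that fails in `s` must end its past with `x`. A strand with past `q ++ [x]` that
      -- some strand of `s` already matches is left alone.
      obtain ⟨C', σ, θ', A, st', c, F, hstep, hC', hθ', hA, hs, hst', hf, hF, hcstr'⟩ :=
        exists_narrowStep_of_executable hcsu hC hθ hcstr hst ((hstr st hst).resolve_left hbad)
          hx.executable
      have hF' : ∀ f ∈ c • F, FactOK s f := fun f hf => by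
        obtain ⟨m, hm, rfl⟩ := hF f (Multiset.mem_of_mem_nsmul hf)
        exact hm
      obtain ⟨C'', μ, θ'', hμ, hr⟩ := ih C' θ' hC' hθ' (fun st₁ h₁ => by
          rcases Multiset.mem_cons.1 (Multiset.mem_of_le hs h₁) with rfl | h
          · exact .inl (hq _ hst')
          · exact hstr st₁ (hA ▸ Multiset.mem_cons_of_mem h)) (fun f h₁ => by
          rcases Multiset.mem_add.1 (Multiset.mem_of_le hf h₁) with h | h
          · exact hfact f h
          · exact .inl (hF' f h)) hcstr' (by
          have h1 := Multiset.countP_le_of_le (fun st => ¬ StrandOK s st) hs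
          have h2 := Multiset.countP_le_of_le (fun f => ¬ FactOK s f) hf
          rw [Multiset.countP_cons_of_neg (p := fun st => ¬ StrandOK s st) _
            (not_not.2 (hq _ hst'))] at h1
          rw [Multiset.countP_add, (Multiset.countP_eq_zero (s := c • F)).2 fun f hf =>
            not_not.2 (hF' f hf)] at h2
          rw [hA, Multiset.countP_cons_of_pos (p := fun st => ¬ StrandOK s st) _ hbad] at hn
          omega)
      exact ⟨C'', _, θ'', .head C C' C'' σ μ hstep hμ, hr⟩
    · push Not at h₁
      by_cases h₂ : ∃ f ∈ factView P.E θ C.st, ¬ FactOK s f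
      · obtain ⟨f, hf, hbad⟩ := h₂
        obtain ⟨m, rfl, hm⟩ := (hfact f hf).resolve_left hbad
        obtain ⟨C', σ, θ', A, st', hstep, hC', hθ', hs, hst', hA, hf', hcstr'⟩ :=
          exists_narrowStep_of_isSentAfter hcsu hC hθ hcstr hf hm
        -- The failure of the positive fact in `s` is precisely the truth of the negative fact that
        -- replaces it.
        have hok : FactOK s (.unknown m) := hbad
        obtain ⟨C'', μ, θ'', hμ, hr⟩ := ih C' θ' hC' hθ' (fun st₁ h => by
            rcases Multiset.mem_cons.1 (Multiset.mem_of_le hs h) with rfl | h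
            · exact .inl (hq _ hst')
            · exact hstr st₁ h) (fun f h => by
            rcases Multiset.mem_cons.1 (Multiset.mem_of_le hf' h) with rfl | h
            · exact .inl hok
            · exact hfact f (hA ▸ Multiset.mem_cons_of_mem h)) hcstr' (by
            have h1 := Multiset.countP_le_of_le (fun st => ¬ StrandOK s st) hs
            have h2 := Multiset.countP_le_of_le (fun f => ¬ FactOK s f) hf'
            rw [Multiset.countP_cons_of_neg (p := fun st => ¬ StrandOK s st) _
            (not_not.2 (hq _ hst'))] at h1
            rw [Multiset.countP_cons_of_neg (p := fun f => ¬ FactOK s f) _ (not_not.2 hok)] at h2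
            rw [hA, Multiset.countP_cons_of_pos (p := fun f => ¬ FactOK s f) _ hbad] at hn
            omega)
        exact ⟨C'', _, θ'', .head C C' C'' σ μ hstep hμ, hr⟩
      · push Not at h₂
        exact ⟨C, _, θ, .refl C, hC, hθ, h₁, h₂, hcstr⟩

/-- Leaving the composite substitution existential avoids proving associativity of `SSubst.comp`. -/
theorem Narrows.trans {C C' C'' : CState Sg Role} {μ μ' : SSubst Sg Role}
    (h : Narrows P csu C μ C') (h' : Narrows P csu C' μ' C'') :
    ∃ μ'', Narrows P csu C μ'' C'' := by
  induction h with
  | refl C => exact ⟨_, h'⟩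
  | head C C₁ C₂ σ μ hs _ ih =>
    obtain ⟨μ'', hμ⟩ := ih h'
    exact ⟨_, .head _ _ _ _ _ hs hμ⟩

theorem Extends.exists_narrows_represents (hcsu : IsUnificationProcedure P.E csu)
    {s s' : FWState P} {q : List (SMsg (Cls P.E))} {x : SMsg (Cls P.E)}
    (hx : Extends P s s' q x) {C : CState Sg Role} {θ : Var Sg → Term Sg Role}
    (h : Represents C θ s') :
    ∃ (C' : CState Sg Role) (μ : SSubst Sg Role) (θ' : Var Sg → Term Sg Role),
      Narrows P csu C μ C' ∧ Represents C' θ' s := by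
  refine hx.exists_narrows hcsu _ C θ h.symbolic h.subst (fun st hst => ?_) (fun f hf => ?_)
    h.cstr le_rfl
  · rcases h.strand st hst with h | ⟨g, hg, h⟩
    · exact .inl (.inl h)
    · rcases hx.strands g hg with hg | hg
      · exact .inl (.inr ⟨g, hg, h⟩)
      · exact .inr (hg ▸ h)
  · have hok := h.fact f hf
    cases f with
    -- Knowledge only grows forwards, so negative facts stay true when going back.
    | unknown m => exact .inl fun hm => hok (hx.ik_subset hm)
    | known m => exact (hx.ik m hok).imp id fun h => ⟨m, rfl, h⟩

theorem FWRuns.exists_narrows [DecidableEq Role] (hcsu : IsUnificationProcedure P.E csu)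
    {α : List (Label Role (Cls P.E))} {s : FWState P} (hs : FWRuns P α s) {C : CState Sg Role}
    {θ : Var Sg → Term Sg Role} (h : Represents C θ s) :
    ∃ (C' : CState Sg Role) (μ : SSubst Sg Role) (θ' : Var Sg → Term Sg Role),
      Narrows P csu C μ C' ∧ Represents C' θ' (FWState.init P) := by
  induction hs generalizing C θ with
  | init => exact ⟨C, _, θ, .refl C, h⟩
  | step α a s s' _ hstep ih =>
    obtain ⟨q, x, hx⟩ := hstep.exists_extends
    obtain ⟨C₁, μ₁, θ₁, hμ₁, h₁⟩ := hx.exists_narrows_represents hcsu h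
    obtain ⟨C₂, μ₂, θ₂, hμ₂, h₂⟩ := ih h₁
    obtain ⟨μ, hμ⟩ := hμ₁.trans hμ₂
    exact ⟨C₂, μ, θ₂, hμ, h₂⟩

theorem Lifts.represents {C : CState Sg Role} {θ : Var Sg → Term Sg Role} {s : FWState P}
    (hC : IsSymbolicState P C) (h : Lifts P C θ s) : Represents C θ s where
  symbolic := hC
  subst := h.ground.1
  strand st hst := by
    obtain ⟨s₀, hs₀, rfl⟩ := Multiset.mem_map.1 hst
    rw [mem_lefts] at hs₀
    obtain ⟨p, f, rfl⟩ := (hC.isSpecStrand hs₀).proper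
    by_cases hp : p = []
    · exact .inl (by rw [hp]; rfl)
    · obtain ⟨g, hg, hgp⟩ := h.strand p _ hs₀ hp
      exact .inr ⟨g, hg, by rw [hgp, Strand.map, mapList_inl]; rfl⟩
  fact f hf := by
    obtain ⟨f₀, hf₀, rfl⟩ := Multiset.mem_map.1 hf
    rw [mem_lefts] at hf₀
    cases f₀ with
    | known m => exact h.known m hf₀
    | unknown m => exact h.unknown m hf₀
  cstr q hq := by
    obtain ⟨p, hp, rfl⟩ := Multiset.mem_map.1 hq
    exact ⟨_, _, Term.ground_subst h.ground.2 p.1, Term.ground_subst h.ground.2 p.2, rfl,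
      fun he => h.cstr p hp (cls_eq_iff.1 he)⟩

theorem Represents.isInitial {C : CState Sg Role} {θ : Var Sg → Term Sg Role}
    (h : Represents C θ (FWState.init P)) : IsInitial C := by
  refine ⟨fun s hs => ?_, fun m hm => ?_⟩
  · rcases h.strand _ (Multiset.mem_map_of_mem _ (mem_lefts.2 hs)) with h | ⟨g, hg, -⟩
    · exact List.map_eq_nil_iff.1 h
    · exact (Multiset.notMem_zero g hg).elim
  · exact h.fact _ (Multiset.mem_map_of_mem _ (mem_lefts.2 hm))

/-- At the initial state all pasts are empty, no positive fact is left, and negative facts hold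
trivially. Only the disequalities constrain the final grounding, which follows `θ` by one chosen
ground term per sort. -/
theorem Represents.exists_lifts {C : CState Sg Role} {θ : Var Sg → Term Sg Role}
    (h : Represents C θ (FWState.init P)) : ∃ θ', Lifts P C θ' (FWState.init P) := by
  choose g hg using P.ground_nonempty
  have hη : IsSubst fun x : Var Sg => g x.sort := fun x => (hg x.sort).1
  have hinit := h.isInitial
  refine ⟨fun x => (θ x).subst fun y => g y.sort, ⟨h.subst.comp hη, fun x =>
    Term.ground_subst (fun y => (hg y.sort).2) _⟩, fun p f hp hne => ?_, fun m hm => ?_,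
    fun m _ hm => hm, fun p hp he => ?_⟩
  · exact (hne (List.map_eq_nil_iff.1 (hinit.1 _ hp))).elim
  · exact (hinit.2 m hm).elim
  · obtain ⟨a, b, ha, hb, hab, hne⟩ := h.cstr _ (Multiset.mem_map_of_mem _ hp)
    simp only [pairView, cview, Prod.mk.injEq] at hab
    have h₁ := congrArg (Cls.subst hη) hab.1
    have h₂ := congrArg (Cls.subst hη) hab.2
    -- Grounding leaves the representatives `a` and `b` untouched, so the two grounded sides still
    -- lie in their distinct classes.
    simp only [Cls.subst_cls, Term.subst_subst, ha.subst, hb.subst] at h₁ h₂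
    exact hne (h₁.symm.trans ((cls_eq_iff.2 he).trans h₂))

end MNPA

theorem mainTheorem5 {Sg : MNPA.Signature.{u, v}} {Role : Type w} [DecidableEq Role]
    (P : MNPA.Protocol Sg Role)
    (csu : MNPA.SState (MNPA.Term Sg Role) → MNPA.SState (MNPA.Term Sg Role) →
      Set (MNPA.SVar Sg) → Set (MNPA.SSubst Sg Role))
    (hcsu : MNPA.IsUnificationProcedure P.E csu)
    (Pst : MNPA.PAState P) (Fst : MNPA.FWState P)
    (CstrS : MNPA.CState Sg Role) (θ' : MNPA.Var Sg → MNPA.Term Sg Role)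
    (hCstrS : MNPA.IsSymbolicState P CstrS)
    (hH : MNPA.RelH P Pst Fst)
    (hlift : MNPA.Lifts P CstrS θ' Fst) :
    ∃ (CstrS₀ : MNPA.CState Sg Role) (μ : MNPA.SSubst Sg Role)
      (θ : MNPA.Var Sg → MNPA.Term Sg Role),
      MNPA.Narrows P csu CstrS μ CstrS₀ ∧
      MNPA.IsSymbolicState P CstrS₀ ∧ MNPA.IsInitial CstrS₀ ∧
      MNPA.Lifts P CstrS₀ θ (MNPA.FWState.init P) := by
  obtain ⟨α, -, hα⟩ := hH
  obtain ⟨C, μ, θ, hμ, hC⟩ := hα.exists_narrows hcsu (hlift.represents hCstrS)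
  obtain ⟨θ₀, hθ₀⟩ := hC.exists_lifts
  exact ⟨C, μ, θ₀, hμ, hC.symbolic, hC.isInitial, hθ₀⟩
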